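/- **Theorem 1.2 (Aomoto Index Theorem).** Let $\mathcal G=(V,E)$ be a finite connected graph, self-loops and multiple edges allowed, without leaves (vertices of degree one, a loop counting twice), and let $p=\#V$. Let $b(v)\in\mathbb R$ ($v\in V$) and $a(e)>0$ ($e\in E$) be given. Let $\pi:\mathcal T\to\mathcal G$ be the universal cover, with the lifted parameters $b(\tilde v)=b(\pi(\tilde v))$, $a(\tilde e)=a(\pi(\tilde e))$, and let $H$ be the bounded self-adjoint operator on $\ell^2(V(\mathcal T))$ whose matrix elements are $H_{\tilde v\tilde v}=b(\tilde v)$, $H_{\tilde v\tilde w}=a(\tilde e)$ if $\tilde v,\tilde w$ are joined by the edge $\tilde e$ of $\mathcal T$, and $0$ otherwise. For $v\in V$ let $d\mu_v$ be the spectral measure of $H$ at $\delta_{\tilde v}$, where $\pi(\tilde v)=v$ (it does not depend on the choice of $\tilde v$), and let $dk=\frac1p\sum_{v\in V}d\mu_v$ be the density of states. Let $\lambda\in\mathbb R$ be an eigenvalue of $H$ (with eigenfunctions in $\ell^2(V(\mathcal T))$). Let $X_1(\lambda)$ be the set of $v\in V$ such that $\psi(\tilde v)\neq0$ for some $\tilde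 v$ with $\pi(\tilde v)=v$ and some $\psi\in\ell^2(V(\mathcal T))$ with $H\psi=\lambda\psi$; let $\partial X_1(\lambda)$ be the set of vertices of $\mathcal G$ not in $X_1(\lambda)$ that are neighbors of points of $X_1(\lambda)$; and let $E(\lambda)$ be the set of edges of $\mathcal G$ with both endpoints in $X_1(\lambda)$. Then $dk$ has a point mass at $\lambda$, of weight $$dk(\{\lambda\})=\frac{I(\lambda)}{p}>0,\qquad I(\lambda)=\#X_1(\lambda)-\#\partial X_1(\lambda)-\#E(\lambda).$$ -/

import Mathlib

open scoped ENNReal NNReal InnerProductSpace CompactlySupported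

/-! ### Spectral measures of bounded self-adjoint operators -/

section SpectralMeasure

variable {F : Type*} [NormedAddCommGroup F] [InnerProductSpace ℂ F] [CompleteSpace F]

/-- The positive linear functional `f ↦ ⟨ψ, f(A) ψ⟩` on `C_c(ℝ)`, where `A` is a bounded
self-adjoint operator and `f(A)` is given by the continuous functional calculus. -/
noncomputable def spectralFunctional (A : F →L[ℂ] F) (hA : IsSelfAdjoint A) (ψ : F) :
    C_c(ℝ, ℝ) →ₚ[ℝ] ℝ :=
  PositiveLinearMap.mk₀
    { toFun := fun f => (⟪ψ, cfc (fun t : ℝ => f t) A ψ⟫_ℂ).re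
      map_add' := fun f g => by
        have h : cfc (fun t : ℝ => (f + g) t) A
            = cfc (fun t : ℝ => f t) A + cfc (fun t : ℝ => g t) A :=
          cfc_add (a := A) (fun t : ℝ => f t) (fun t : ℝ => g t)
            f.continuous.continuousOn g.continuous.continuousOn
        rw [h, add_apply, inner_add_right, Complex.add_re]
      map_smul' := fun c f => by
        have h : cfc (fun t : ℝ => (c • f) t) A = c • cfc (fun t : ℝ => f t) A :=
          cfc_smul (a := A) c (fun t : ℝ => f t) f.continuous.continuousOn
        rw [h, smul_apply, inner_smul_right_eq_smul]
        simp }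
    (fun f hf => by
      have h : 0 ≤ cfc (fun t : ℝ => f t) A := cfc_nonneg (fun t _ => hf t)
      have h' := (ContinuousLinearMap.nonneg_iff_isPositive _).1 h
      have := h'.inner_nonneg_right ψ
      exact (Complex.le_def.1 this).1)

/-- The spectral measure of the bounded self-adjoint operator `A` at the vector `ψ`: the Borel
measure `μ` on `ℝ` with `∫ f dμ = ⟨ψ, f(A) ψ⟩` for all `f ∈ C_c(ℝ)`. -/
noncomputable def spectralMeasure (A : F →L[ℂ] F) (hA : IsSelfAdjoint A) (ψ : F) :
    MeasureTheory.Measure ℝ :=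
  RealRMK.rieszMeasure (spectralFunctional A hA ψ)

end SpectralMeasure

/-! ### Bounded operators on `ℓ²` given by a matrix -/

section MatrixOperator

variable {ι : Type*}

/-- The Hilbert space `ℓ²(ι)` of square-summable complex functions on `ι`. -/
abbrev EllTwo (ι : Type*) : Type _ := lp (fun _ : ι => ℂ) 2

/-- The unit vector `δ_x` of `ℓ²(ι)`. -/
noncomputable def deltaVec (x : ι) : EllTwo ι :=
  letI := Classical.decEq ι
  lp.single 2 x (1 : ℂ)

/-- The matrix `M` is symmetric and its absolute row sums are bounded by `C`. -/
structure IsSchurBounded (M : ι → ι → ℝ) (C : ℝ≥0) : Prop where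
  symm : ∀ x y, M x y = M y x
  row_le : ∀ x, ∑' y, ‖M x y‖ₑ ≤ C

lemma ennreal_schur_row (m g : ι → ℝ≥0∞) :
    (∑' y, m y * g y) ^ 2 ≤ (∑' y, m y) * ∑' y, m y * g y ^ 2 := by
  have key : ∀ a b : ℝ≥0∞, 2 * (a * b) ≤ a ^ 2 + b ^ 2 := by
    intro a b
    rcases eq_or_ne a ⊤ with rfl | ha
    · simp
    rcases eq_or_ne b ⊤ with rfl | hb
    · simp
    lift a to ℝ≥0 using ha
    lift b to ℝ≥0 using hb
    norm_cast
    have := two_mul_le_add_sq (a : ℝ) b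
    rw [← NNReal.coe_le_coe]
    push_cast
    linarith
  have e1 : (∑' y, m y * g y) ^ 2 = ∑' y, ∑' z, (m y * m z) * (g y * g z) := by
    rw [sq, ← ENNReal.tsum_mul_right]
    refine tsum_congr fun y => ?_
    rw [← ENNReal.tsum_mul_left]
    exact tsum_congr fun z => by ring
  have e2 : (∑' y, m y) * ∑' y, m y * g y ^ 2 = ∑' y, ∑' z, (m y * m z) * g z ^ 2 := by
    rw [← ENNReal.tsum_mul_right]
    refine tsum_congr fun y => ?_
    rw [← ENNReal.tsum_mul_left]
    exact tsum_congr fun z => by ring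
  have e3 : (∑' y, m y) * ∑' y, m y * g y ^ 2 = ∑' y, ∑' z, (m y * m z) * g y ^ 2 := by
    rw [e2, ENNReal.tsum_comm]
    exact tsum_congr fun y => tsum_congr fun z => by ring
  have h2 : 2 * (∑' y, m y * g y) ^ 2 ≤ 2 * ((∑' y, m y) * ∑' y, m y * g y ^ 2) := by
    calc 2 * (∑' y, m y * g y) ^ 2
        = ∑' y, ∑' z, (m y * m z) * (2 * (g y * g z)) := by
          rw [e1, ← ENNReal.tsum_mul_left]
          refine tsum_congr fun y => ?_
          rw [← ENNReal.tsum_mul_left]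
          exact tsum_congr fun z => by ring
      _ ≤ ∑' y, ∑' z, (m y * m z) * (g y ^ 2 + g z ^ 2) :=
          ENNReal.tsum_le_tsum fun y => ENNReal.tsum_le_tsum fun z =>
            mul_le_mul_right (key _ _) _
      _ = (∑' y, ∑' z, (m y * m z) * g y ^ 2) + ∑' y, ∑' z, (m y * m z) * g z ^ 2 := by
          rw [← ENNReal.tsum_add]
          refine tsum_congr fun y => ?_
          rw [← ENNReal.tsum_add]
          exact tsum_congr fun z => by ring
      _ = 2 * ((∑' y, m y) * ∑' y, m y * g y ^ 2) := by
          rw [← e2, ← e3, two_mul]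
  exact (ENNReal.mul_le_mul_iff_right (by simp) (by simp)).1 h2

lemma ennreal_schur {M : ι → ι → ℝ} {C : ℝ≥0} (hM : IsSchurBounded M C) (g : ι → ℝ≥0∞) :
    ∑' x, (∑' y, ‖M x y‖ₑ * g y) ^ 2 ≤ (C : ℝ≥0∞) ^ 2 * ∑' y, g y ^ 2 := by
  calc ∑' x, (∑' y, ‖M x y‖ₑ * g y) ^ 2
      ≤ ∑' x, (C : ℝ≥0∞) * ∑' y, ‖M x y‖ₑ * g y ^ 2 :=
        ENNReal.tsum_le_tsum fun x =>
          (ennreal_schur_row _ _).trans (mul_le_mul_left (hM.row_le x) _)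
    _ = C * ∑' y, g y ^ 2 * ∑' x, ‖M y x‖ₑ := by
        rw [ENNReal.tsum_mul_left, ENNReal.tsum_comm]
        congr 1
        refine tsum_congr fun y => ?_
        rw [← ENNReal.tsum_mul_left]
        exact tsum_congr fun x => by rw [hM.symm x y, mul_comm]
    _ ≤ C * ∑' y, g y ^ 2 * C := by
        refine mul_le_mul_right (ENNReal.tsum_le_tsum fun y => ?_) _
        exact mul_le_mul_right (hM.row_le y) _
    _ = (C : ℝ≥0∞) ^ 2 * ∑' y, g y ^ 2 := by
        rw [ENNReal.tsum_mul_right]; ring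

lemma ellTwo_tsum_enorm (ψ : EllTwo ι) :
    ∑' y, ‖ψ y‖ₑ ^ 2 = ENNReal.ofReal (‖ψ‖ ^ 2) := by
  have hs : HasSum (fun y => ‖ψ y‖ ^ 2) (‖ψ‖ ^ 2) := by
    have := lp.hasSum_norm (p := 2) (by norm_num) ψ
    simpa using this
  rw [← hs.tsum_eq, ENNReal.ofReal_tsum_of_nonneg (fun _ => by positivity) hs.summable]
  refine tsum_congr fun y => ?_
  rw [ENNReal.ofReal_pow (norm_nonneg _), ofReal_norm]

lemma schur_bound {M : ι → ι → ℝ} {C : ℝ≥0} (hM : IsSchurBounded M C) (ψ : EllTwo ι) :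
    ∑' x, (∑' y, ‖(M x y : ℂ) * ψ y‖ₑ) ^ 2 ≤ ENNReal.ofReal ((C * ‖ψ‖) ^ 2) := by
  have h := ennreal_schur hM (fun y => ‖ψ y‖ₑ)
  rw [ellTwo_tsum_enorm] at h
  have e : ∀ x y, ‖(M x y : ℂ) * ψ y‖ₑ = ‖M x y‖ₑ * ‖ψ y‖ₑ := fun x y => by
    rw [enorm_mul]; congr 1
    rw [← ofReal_norm, ← ofReal_norm, Complex.norm_real]
  simp only [e]
  refine h.trans (le_of_eq ?_)
  rw [mul_pow, ENNReal.ofReal_mul (by positivity), ENNReal.ofReal_pow C.coe_nonneg,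
    ENNReal.ofReal_coe_nnreal]

lemma schur_summable {M : ι → ι → ℝ} {C : ℝ≥0} (hM : IsSchurBounded M C) (ψ : EllTwo ι) (x : ι) :
    Summable fun y => (M x y : ℂ) * ψ y := by
  have h : (∑' y, ‖(M x y : ℂ) * ψ y‖ₑ) ^ 2 < ⊤ :=
    ((ENNReal.le_tsum x).trans (schur_bound hM ψ)).trans_lt ENNReal.ofReal_lt_top
  have h' : ∑' y, ‖(M x y : ℂ) * ψ y‖ₑ ≠ ⊤ := by
    intro ht; rw [ht] at h; simp at h
  refine Summable.of_norm ?_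
  have := ENNReal.summable_toReal h'
  simpa using this

lemma enorm_tsum_sq_le {M : ι → ι → ℝ} {C : ℝ≥0} (hM : IsSchurBounded M C) (ψ : EllTwo ι) :
    ∑' x, ‖∑' y, (M x y : ℂ) * ψ y‖ₑ ^ 2 ≤ ENNReal.ofReal ((C * ‖ψ‖) ^ 2) := by
  refine (ENNReal.tsum_le_tsum fun x => ?_).trans (schur_bound hM ψ)
  exact pow_le_pow_left' (enorm_tsum_le_tsum_enorm) 2

lemma schur_memℓp {M : ι → ι → ℝ} {C : ℝ≥0} (hM : IsSchurBounded M C) (ψ : EllTwo ι) :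
    Memℓp (fun x => ∑' y, (M x y : ℂ) * ψ y) 2 := by
  refine memℓp_gen ?_
  have h : ∑' x, ‖∑' y, (M x y : ℂ) * ψ y‖ₑ ^ 2 ≠ ⊤ :=
    ((enorm_tsum_sq_le hM ψ).trans_lt ENNReal.ofReal_lt_top).ne
  have := ENNReal.summable_toReal h
  simpa using this

/-- The bounded operator on `ℓ²(ι)` with matrix `M`: `(A ψ)(x) = ∑_y M x y ψ(y)`. -/
noncomputable def matrixOperator (M : ι → ι → ℝ) {C : ℝ≥0} (hM : IsSchurBounded M C) :
    EllTwo ι →L[ℂ] EllTwo ι :=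
  LinearMap.mkContinuous
    { toFun := fun ψ => ⟨fun x => ∑' y, (M x y : ℂ) * ψ y, schur_memℓp hM ψ⟩
      map_add' := fun φ ψ => by
        ext x
        change ∑' y, (M x y : ℂ) * (φ y + ψ y) = _ + _
        simp only [mul_add]
        exact (schur_summable hM φ x).tsum_add (schur_summable hM ψ x)
      map_smul' := fun c ψ => by
        ext x
        change ∑' y, (M x y : ℂ) * (c * ψ y) = c * ∑' y, (M x y : ℂ) * ψ y
        rw [← tsum_mul_left]
        exact tsum_congr fun y => by ring }
    C (fun ψ => by
      set φ : EllTwo ι := ⟨fun x => ∑' y, (M x y : ℂ) * ψ y, schur_memℓp hM ψ⟩ with hφ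
      have h : ENNReal.ofReal (‖φ‖ ^ 2) ≤ ENNReal.ofReal ((C * ‖ψ‖) ^ 2) := by
        rw [← ellTwo_tsum_enorm]
        exact enorm_tsum_sq_le hM ψ
      rw [ENNReal.ofReal_le_ofReal_iff (by positivity)] at h
      exact le_of_sq_le_sq h (by positivity))

lemma matrixOperator_apply (M : ι → ι → ℝ) {C : ℝ≥0} (hM : IsSchurBounded M C) (ψ : EllTwo ι)
    (x : ι) : matrixOperator M hM ψ x = ∑' y, (M x y : ℂ) * ψ y := rfl

lemma matrixOperator_deltaVec (M : ι → ι → ℝ) {C : ℝ≥0} (hM : IsSchurBounded M C) (x y : ι) :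
    matrixOperator M hM (deltaVec y) x = M x y := by
  classical
  rw [matrixOperator_apply, tsum_eq_single y]
  · simp [deltaVec]
  · intro z hz
    simp [deltaVec, hz]

lemma matrixOperator_isSelfAdjoint (M : ι → ι → ℝ) {C : ℝ≥0} (hM : IsSchurBounded M C) :
    IsSelfAdjoint (matrixOperator M hM) := by
  let _ := Classical.decEq ι
  have hd : ∀ (x : ι) (c : ℂ), (lp.single 2 x c : EllTwo ι) = c • deltaVec x := fun x c => by
    rw [deltaVec, ← lp.single_smul]; simp
  rw [ContinuousLinearMap.isSelfAdjoint_iff']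
  refine lp.ext_continuousLinearMap (by norm_num) fun y => ?_
  have h1 : ∀ (z : ι) (ψ : EllTwo ι), ψ z = ⟪(deltaVec z : EllTwo ι), ψ⟫_ℂ := fun z ψ => by
    rw [deltaVec, lp.inner_single_left]; simp
  have h2 : ContinuousLinearMap.adjoint (matrixOperator M hM) (deltaVec y)
      = matrixOperator M hM (deltaVec y) := by
    ext x
    rw [h1 x (ContinuousLinearMap.adjoint _ _), ContinuousLinearMap.adjoint_inner_right,
      ← inner_conj_symm, ← h1, matrixOperator_deltaVec, matrixOperator_deltaVec, hM.symm]
    simp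
  refine ContinuousLinearMap.ext fun c => ?_
  change ContinuousLinearMap.adjoint (matrixOperator M hM) (lp.single 2 y c)
    = matrixOperator M hM (lp.single 2 y c)
  rw [hd, map_smul, map_smul, h2]

end MatrixOperator

/-! ### Finite multigraphs and their universal covers -/

/-- A multigraph with vertex set `V` and edge set `E`, loops and multiple edges allowed, each edge
`e` carrying a chosen orientation from `src e` to `tgt e`. -/
structure Multigraph (V E : Type*) where
  src : E → V
  tgt : E → V

namespace Multigraph

variable {V E : Type*}

/-- Oriented edges: `(e, false)` is the edge `e` with its chosen orientation and `(e, true)` is `e`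
with the opposite orientation. A loop, too, has two orientations. -/
abbrev Dart (E : Type*) : Type _ := E × Bool

/-- The oppositely oriented edge. -/
def rev (d : Dart E) : Dart E := (d.1, !d.2)

/-- Initial vertex of an oriented edge. -/
def init (G : Multigraph V E) (d : Dart E) : V := if d.2 then G.tgt d.1 else G.src d.1

/-- Final vertex of an oriented edge. -/
def term (G : Multigraph V E) (d : Dart E) : V := if d.2 then G.src d.1 else G.tgt d.1

/-- `u` and `v` are joined by an edge. -/
def Adj (G : Multigraph V E) (u v : V) : Prop := ∃ d : Dart E, G.init d = u ∧ G.term d = v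

/-- Any two vertices are joined by a path. -/
def IsConnected (G : Multigraph V E) : Prop := ∀ u v : V, Relation.ReflTransGen G.Adj u v

/-- No vertex has degree one (a loop counts twice in the degree of its vertex). -/
def IsLeafless (G : Multigraph V E) : Prop := ∀ v : V, {d : Dart E | G.init d = v}.ncard ≠ 1

/-- The final vertex of a walk that starts at `v₀`; the walk is the list of its oriented edges, the
last edge first. -/
def endpoint (G : Multigraph V E) (v₀ : V) : List (Dart E) → V
  | [] => v₀
  | d :: _ => G.term d

/-- The list of oriented edges (last edge first) is a walk that starts at `v₀` and is reduced: no
edge is followed by the same edge with the opposite orientation. -/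
def IsReducedWalk (G : Multigraph V E) (v₀ : V) : List (Dart E) → Prop
  | [] => True
  | d :: w => G.init d = G.endpoint v₀ w ∧ (∀ d' ∈ w.head?, d ≠ rev d') ∧ G.IsReducedWalk v₀ w

/-- The vertex set of the universal cover of `G` with base vertex `v₀`: reduced walks from `v₀`. -/
abbrev Cover (G : Multigraph V E) (v₀ : V) : Type _ := {w : List (Dart E) // G.IsReducedWalk v₀ w}

/-- The covering map on vertices. -/
def proj (G : Multigraph V E) (v₀ : V) (x : G.Cover v₀) : V := G.endpoint v₀ x.1

/-- The universal cover has an oriented edge from `x` to `y` that lies over the oriented edge `d` of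
`G`: the walk `y` is obtained from the walk `x` by appending `d`, with cancellation if `x` ends in
the opposite of `d`. -/
def IsLift (G : Multigraph V E) (v₀ : V) (d : Dart E) (x y : G.Cover v₀) : Prop :=
  y.1 = d :: x.1 ∨ x.1 = rev d :: y.1

/-- Jacobi parameters: a real potential `b` on the vertices, a coupling `a > 0` on the edges. -/
structure JacobiParameters (V E : Type*) where
  b : V → ℝ
  a : E → ℝ
  a_pos : ∀ e, 0 < a e

open Classical in
/-- The Jacobi matrix on the universal cover: `b` of the vertex below on the diagonal, `a` of the
edge below for two adjacent vertices, and `0` otherwise. (At most one term of the sum is not zero.)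
-/
noncomputable def jacobiMatrix [Fintype E] (G : Multigraph V E) (J : JacobiParameters V E) (v₀ : V)
    (x y : G.Cover v₀) : ℝ :=
  if x = y then J.b (G.proj v₀ x) else ∑ d : Dart E, if G.IsLift v₀ d x y then J.a d.1 else 0

lemma rev_rev (d : Dart E) : rev (rev d) = d := by simp [rev]

lemma isLift_rev (G : Multigraph V E) (v₀ : V) (d : Dart E) (x y : G.Cover v₀) :
    G.IsLift v₀ (rev d) x y ↔ G.IsLift v₀ d y x := by
  simp only [IsLift, rev_rev]; tauto

/-- The covering map is surjective, so that every vertex of `G` has a lift. -/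
lemma exists_proj_eq (G : Multigraph V E) (hG : G.IsConnected) (v₀ v : V) :
    ∃ x, G.proj v₀ x = v := by
  induction hG v₀ v with
  | refl => exact ⟨⟨[], trivial⟩, rfl⟩
  | tail _ h ih =>
    obtain ⟨x, hx⟩ := ih
    obtain ⟨d, hd, hd'⟩ := h
    by_cases hc : ∀ d' ∈ x.1.head?, d ≠ rev d'
    · exact ⟨⟨d :: x.1, hd.trans hx.symm, hc, x.2⟩, hd'⟩
    · push Not at hc
      obtain ⟨d', hm, rfl⟩ := hc
      obtain ⟨w, hw⟩ := x
      cases w with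
      | nil => simp at hm
      | cons e w =>
        obtain rfl : e = d' := by simpa using hm
        refine ⟨⟨w, hw.2.2⟩, ?_⟩
        rw [← hd']
        refine hw.1.symm.trans ?_
        rcases e with ⟨e, _ | _⟩ <;> rfl

lemma tsum_ite_le_of_subsingleton {ι : Type*} (P : ι → Prop) [DecidablePred P]
    (hP : ∀ x y, P x → P y → x = y) (c : ℝ≥0∞) : ∑' y, (if P y then c else 0) ≤ c := by
  by_cases h : ∃ y, P y
  · obtain ⟨y, hy⟩ := h
    rw [tsum_eq_single y fun z hz => if_neg fun hz' => hz (hP z y hz' hy), if_pos hy]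
  · push Not at h
    simp [h]

lemma jacobiMatrix_isSchurBounded [Fintype V] [Fintype E] (G : Multigraph V E)
    (J : JacobiParameters V E) (v₀ : V) : IsSchurBounded (G.jacobiMatrix J v₀)
      (∑ v : V, ‖J.b v‖₊ + ∑ d : Dart E, (‖J.a d.1‖₊ + ‖J.a d.1‖₊)) := by
  classical
  constructor
  · intro x y
    unfold jacobiMatrix
    by_cases h : x = y
    · simp [h]
    · rw [if_neg h, if_neg (Ne.symm h)]
      refine Fintype.sum_equiv ⟨rev, rev, rev_rev, rev_rev⟩ _ _ fun d => ?_
      change _ = if G.IsLift v₀ (rev d) y x then J.a (rev d).1 else 0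
      rw [if_congr (G.isLift_rev v₀ d y x) rfl rfl]
      rfl
  · intro x
    have hle : ∀ y, ‖G.jacobiMatrix J v₀ x y‖ₑ ≤
        (if x = y then ‖J.b (G.proj v₀ x)‖ₑ else 0) +
          ∑ d : Dart E, ((if y.1 = d :: x.1 then ‖J.a d.1‖ₑ else 0) +
            (if x.1 = rev d :: y.1 then ‖J.a d.1‖ₑ else 0)) := by
      intro y
      unfold jacobiMatrix
      by_cases h : x = y
      · rw [if_pos h, if_pos h]; exact le_self_add
      · rw [if_neg h, if_neg h, zero_add]
        refine (enorm_sum_le _ _).trans (Finset.sum_le_sum fun d _ => ?_)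
        by_cases h1 : y.1 = d :: x.1
        · rw [if_pos (show G.IsLift v₀ d x y from Or.inl h1), if_pos h1]; exact le_self_add
        · by_cases h2 : x.1 = rev d :: y.1
          · rw [if_pos (show G.IsLift v₀ d x y from Or.inr h2), if_pos h2]; exact le_add_self
          · rw [if_neg (by rintro (h | h); exacts [h1 h, h2 h])]; simp
    refine (ENNReal.tsum_le_tsum hle).trans ?_
    rw [ENNReal.tsum_add, Summable.tsum_finsetSum fun _ _ => ENNReal.summable]
    push_cast
    refine add_le_add ?_ (Finset.sum_le_sum fun d _ => ?_)
    · refine (tsum_ite_le_of_subsingleton _ (fun y z hy hz => hy.symm.trans hz) _).trans ?_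
      exact Finset.single_le_sum (f := fun v => ((‖J.b v‖₊ : ℝ≥0) : ℝ≥0∞)) (fun _ _ => zero_le)
        (Finset.mem_univ _)
    · rw [ENNReal.tsum_add]
      refine add_le_add ?_ ?_
      · exact tsum_ite_le_of_subsingleton _ (fun y z hy hz => Subtype.ext (hy.trans hz.symm)) _
      · exact tsum_ite_le_of_subsingleton _
          (fun y z hy hz => Subtype.ext (List.cons.inj (hy.symm.trans hz)).2) _

variable [Fintype V] [Fintype E]

/-- The periodic Jacobi operator `H` on `ℓ²` of the universal cover. -/
noncomputable def jacobiOperator (G : Multigraph V E) (J : JacobiParameters V E) (v₀ : V) :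
    EllTwo (G.Cover v₀) →L[ℂ] EllTwo (G.Cover v₀) :=
  matrixOperator (G.jacobiMatrix J v₀) (G.jacobiMatrix_isSchurBounded J v₀)

lemma jacobiOperator_isSelfAdjoint (G : Multigraph V E) (J : JacobiParameters V E) (v₀ : V) :
    IsSelfAdjoint (G.jacobiOperator J v₀) :=
  matrixOperator_isSelfAdjoint _ _

/-- The density of states `dk = p⁻¹ ∑_v dμ_v`, where `p` is the number of vertices of `G` and `μ_v`
is the spectral measure of `H` at `δ_x`, for a vertex `x = lift v` of the universal cover that lies
over `v`. -/
noncomputable def densityOfStates (G : Multigraph V E) (J : JacobiParameters V E) (v₀ : V)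
    (lift : V → G.Cover v₀) : MeasureTheory.Measure ℝ :=
  (Fintype.card V : ℝ≥0∞)⁻¹ • ∑ v : V,
    spectralMeasure (G.jacobiOperator J v₀) (G.jacobiOperator_isSelfAdjoint J v₀)
      (deltaVec (lift v))

/-- `X₁(lam)`: the vertices of `G` below a vertex of the universal cover at which some
eigenfunction `ψ ∈ ℓ²` with `H ψ = lam ψ` does not vanish. -/
def eigenVertices (G : Multigraph V E) (J : JacobiParameters V E) (v₀ : V) (lam : ℝ) : Set V :=
  {v | ∃ x : G.Cover v₀, G.proj v₀ x = v ∧ ∃ ψ : EllTwo (G.Cover v₀),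
    G.jacobiOperator J v₀ ψ = (lam : ℂ) • ψ ∧ ψ x ≠ 0}

/-- The outer boundary of a set of vertices: the vertices not in `X` with a neighbor in `X`. -/
def outerBoundary (G : Multigraph V E) (X : Set V) : Set V := {v | v ∉ X ∧ ∃ u ∈ X, G.Adj u v}

/-- The (unoriented) edges with both ends in `X`. -/
def edgesInside (G : Multigraph V E) (X : Set V) : Set E := {e | G.src e ∈ X ∧ G.tgt e ∈ X}

/-- The index `I(lam) = #X₁(lam) - #∂X₁(lam) - #E(lam)`. -/
noncomputable def aomotoIndex (G : Multigraph V E) (J : JacobiParameters V E) (v₀ : V) (lam : ℝ) :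
    ℤ :=
  ((G.eigenVertices J v₀ lam).ncard : ℤ) - (G.outerBoundary (G.eigenVertices J v₀ lam)).ncard
    - (G.edgesInside (G.eigenVertices J v₀ lam)).ncard

end Multigraph

/-! Let `P` be the projection to the eigenspace and `p_x = P δ_x` its columns (`eigenColumn`). The
atom of a spectral measure at `lam` is `‖P ψ‖²`, so `p · dk({lam})` is the sum of `‖p_x‖²` over one
lift `x` of each vertex. This sum is positive, since some eigenfunction is nonzero somewhere. It
remains to compute it.

Removing an edge `xy` splits the tree. By the vanishing Wronskian (`eigenvector_cross`) the pairs
`(ψ x, ψ y)` of all eigenfunctions are proportional, and so are `p_x` and `p_y`. For an oriented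
edge `d` out of `x` let `m(d)` be the fraction of `‖p_x‖²` carried by the branch behind `d`; deck
transformations show that it depends only on the edge of `G`. Three identities hold. (1) At a vertex
of `X₁`, `‖p_x‖² = 1 - ∑ m(d)` over the outgoing `d`, because `p_x(x) = ‖p_x‖²`
(`sum_branchFraction_out`). (2) On an edge inside `X₁`, `m(d) + m(rev d) = 1`, because the two
branches are complementary and the two columns proportional (`branchFraction_add_rev`). (3) At a
vertex of `∂X₁`, the `m(d)` of the edges entering from `X₁` add up to `1` (`sum_branchFraction_in`).
Here `δ_y = (H - lam) w` with `w` orthogonal to the eigenspace, and `m(d)` is the coupling times the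
value of `w` at the neighbor. Summing (1) over the vertices, with each oriented edge out of `X₁`
falling under (2) or (3), gives the index. -/

/-! ### Atoms of spectral measures as norms of eigenprojections. -/

section SpectralAtoms

open Filter Topology MeasureTheory

variable {F : Type*} [NormedAddCommGroup F] [InnerProductSpace ℂ F]

/-- The eigenspace of the bounded operator `A` at the real number `lam`, as a kernel. -/
noncomputable abbrev eigenKer (A : F →L[ℂ] F) (lam : ℝ) : Submodule ℂ F :=
  (A - (lam : ℂ) • (1 : F →L[ℂ] F)).ker

lemma mem_eigenKer {A : F →L[ℂ] F} {lam : ℝ} {ψ : F} :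
    ψ ∈ eigenKer A lam ↔ A ψ = (lam : ℂ) • ψ := by
  rw [LinearMap.mem_ker]
  simp [sub_eq_zero]

variable [CompleteSpace F]

lemma isSelfAdjoint_sub_real_smul {A : F →L[ℂ] F} (hA : IsSelfAdjoint A) (lam : ℝ) :
    IsSelfAdjoint (A - (lam : ℂ) • (1 : F →L[ℂ] F)) := by
  refine hA.sub ?_
  refine IsSelfAdjoint.smul ?_ (IsSelfAdjoint.one _)
  simp [IsSelfAdjoint]

lemma cfc_sub_real {A : F →L[ℂ] F} (hA : IsSelfAdjoint A) (lam : ℝ) :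
    cfc (fun t : ℝ => t - lam) A = A - (lam : ℂ) • (1 : F →L[ℂ] F) := by
  rw [cfc_sub (fun t : ℝ => t) (fun _ => lam) A, cfc_id' ℝ A, cfc_const lam A]
  congr 1

/-- The tent function of height one and half-width `1 / n` centered at `lam`. -/
noncomputable def tent (lam : ℝ) (n : ℕ) (t : ℝ) : ℝ := max 0 (1 - n * |t - lam|)

lemma continuous_tent (lam : ℝ) (n : ℕ) : Continuous (tent lam n) := by
  unfold tent; fun_prop

lemma tent_self (lam : ℝ) (n : ℕ) : tent lam n lam = 1 := by simp [tent]

lemma tent_nonneg (lam : ℝ) (n : ℕ) (t : ℝ) : 0 ≤ tent lam n t := le_max_left _ _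

lemma tent_le_one (lam : ℝ) (n : ℕ) (t : ℝ) : tent lam n t ≤ 1 :=
  max_le zero_le_one (by have : 0 ≤ n * |t - lam| := by positivity
                         linarith)

lemma tent_anti (lam : ℝ) (t : ℝ) {m n : ℕ} (h : m ≤ n) : tent lam n t ≤ tent lam m t := by
  unfold tent
  gcongr

lemma tent_eq_zero {lam t : ℝ} {n : ℕ} (h : 1 ≤ n * |t - lam|) : tent lam n t = 0 :=
  max_eq_left (by linarith)

lemma one_sub_tent_sq_le (lam : ℝ) (n : ℕ) (t : ℝ) :
    (1 - tent lam n t) ^ 2 ≤ (n * (t - lam)) ^ 2 := by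
  have h0 := tent_le_one lam n t
  have h1 : 1 - tent lam n t ≤ n * |t - lam| := by
    have := le_max_right 0 (1 - n * |t - lam|)
    unfold tent; linarith
  rw [mul_pow, ← sq_abs (t - lam), ← mul_pow]
  exact pow_le_pow_left₀ (by linarith) h1 2

lemma abs_tent_mul_le (lam : ℝ) {n : ℕ} (hn : 0 < n) (t : ℝ) :
    |tent lam n t * (t - lam)| ≤ 1 / n := by
  have hn' : (0 : ℝ) < n := by exact_mod_cast hn
  rw [abs_mul, abs_of_nonneg (tent_nonneg _ _ _), le_div_iff₀ hn']
  rcases le_total 1 (n * |t - lam|) with h | h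
  · rw [tent_eq_zero h]; simp
  · calc tent lam n t * |t - lam| * n = tent lam n t * (n * |t - lam|) := by ring
      _ ≤ 1 * 1 := mul_le_mul (tent_le_one _ _ _) h (by positivity) zero_le_one
      _ = 1 := one_mul 1

/-- The tent function as a compactly supported continuous function. -/
noncomputable def tentCc (lam : ℝ) (n : ℕ) (hn : 0 < n) : C_c(ℝ, ℝ) where
  toFun := tent lam n
  continuous_toFun := continuous_tent lam n
  hasCompactSupport' := by
    refine HasCompactSupport.of_support_subset_isCompact
      (isCompact_Icc (a := lam - 1) (b := lam + 1)) fun t ht => ?_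
    by_contra h
    refine ht (tent_eq_zero ?_)
    have h1 : 1 ≤ |t - lam| := by
      by_contra h2
      push Not at h2
      rw [abs_lt] at h2
      exact h ⟨by linarith, by linarith⟩
    have hn' : (1 : ℝ) ≤ n := by exact_mod_cast hn
    nlinarith

/-- The functional calculus is monotone, so `one_sub_tent_sq_le` yields `‖(1 - T) ψ‖² ≤ n² ‖(A -
lam) ψ‖² = 0`, where `T` is the tent function of `A`. -/
lemma cfc_tent_eigenvector {A : F →L[ℂ] F} (hA : IsSelfAdjoint A) (lam : ℝ) (n : ℕ) {ψ : F}
    (hψ : ψ ∈ eigenKer A lam) : cfc (tent lam n) A ψ = ψ := by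
  have hc := continuous_tent lam n
  set B := cfc (fun t => 1 - tent lam n t) A with hB
  have hBsa : IsSelfAdjoint B := cfc_predicate _ A
  have e1 : B = 1 - cfc (tent lam n) A := by
    rw [hB, cfc_sub (fun _ => (1 : ℝ)) (tent lam n) A (by fun_prop) (by fun_prop),
      cfc_const_one ℝ A]
  have e2 : B * B = cfc (fun t => (1 - tent lam n t) ^ 2) A := by
    rw [← sq, hB, ← cfc_pow _ 2 A (by fun_prop)]
  have e3 : cfc (fun t : ℝ => (n * (t - lam)) ^ 2) A
      = ((n : ℝ) ^ 2) • ((A - (lam : ℂ) • 1) * (A - (lam : ℂ) • 1)) := by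
    rw [← cfc_sub_real hA, ← sq, ← cfc_pow _ 2 A (by fun_prop), ← cfc_smul _ _ A (by fun_prop)]
    refine cfc_congr fun t _ => ?_
    simp [mul_pow]
  have hle : B * B ≤ ((n : ℝ) ^ 2) • ((A - (lam : ℂ) • 1) * (A - (lam : ℂ) • 1)) := by
    rw [e2, ← e3]
    exact cfc_mono (fun t _ => one_sub_tent_sq_le lam n t) (by fun_prop) (by fun_prop)
  have hpos := (ContinuousLinearMap.le_def _ _).1 hle
  have h := hpos.re_inner_nonneg_right ψ
  have hker : (A - (lam : ℂ) • (1 : F →L[ℂ] F)) ψ = 0 := hψ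
  have hs : ⟪ψ, (B * B) ψ⟫_ℂ = ⟪B ψ, B ψ⟫_ℂ := by
    rw [mul_apply_eq_comp]
    exact (hBsa.isSymmetric ψ (B ψ)).symm
  rw [sub_apply, inner_sub_right, hs, smul_apply, mul_apply_eq_comp, hker] at h
  simp only [map_zero, smul_zero, inner_zero_right, zero_sub, map_neg, inner_self_eq_norm_sq] at h
  have hz : B ψ = 0 := by
    rw [← norm_eq_zero]
    nlinarith [norm_nonneg (B ψ)]
  rw [e1, sub_apply, sub_eq_zero] at hz
  exact hz.symm

lemma norm_cfc_tent_le_one (A : F →L[ℂ] F) (lam : ℝ) (n : ℕ) : ‖cfc (tent lam n) A‖ ≤ 1 :=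
  norm_cfc_le zero_le_one fun t _ => by
    rw [Real.norm_of_nonneg (tent_nonneg _ _ _)]; exact tent_le_one _ _ _

/-- The orthogonal complement of the kernel of the self-adjoint `A - lam` is the closure of its
range. On the range the tent operators decay, since `tent * (t - lam)` is at most `1 / n`; their
norm bound `1` carries this to the closure. -/
lemma tendsto_cfc_tent_orthogonal {A : F →L[ℂ] F} (hA : IsSelfAdjoint A) (lam : ℝ) {ψ : F}
    (hψ : ψ ∈ (eigenKer A lam)ᗮ) :
    Tendsto (fun n : ℕ => cfc (tent lam n) A ψ) atTop (𝓝 0) := by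
  set B := A - (lam : ℂ) • (1 : F →L[ℂ] F) with hB
  have hBsa : IsSelfAdjoint B := isSelfAdjoint_sub_real_smul hA lam
  rw [ContinuousLinearMap.orthogonal_ker, hBsa.adjoint_eq] at hψ
  rw [Metric.tendsto_atTop]
  intro ε hε
  obtain ⟨_, ⟨χ, rfl⟩, hχ⟩ := Metric.mem_closure_iff.1 hψ (ε / 2) (by positivity)
  change dist ψ (B χ) < _ at hχ
  obtain ⟨N, hN⟩ := exists_nat_gt (‖χ‖ / (ε / 2))
  refine ⟨N + 1, fun n hn => ?_⟩
  have hn0 : 0 < n := by omega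
  have hn' : (0 : ℝ) < n := by exact_mod_cast hn0
  have hNn : (N : ℝ) ≤ n := by exact_mod_cast (by omega : N ≤ n)
  have hT : ‖cfc (tent lam n) A * B‖ ≤ 1 / n := by
    have hc := continuous_tent lam n
    rw [hB, ← cfc_sub_real hA, ← cfc_mul _ _ A (by fun_prop) (by fun_prop)]
    exact norm_cfc_le (by positivity) fun t _ => abs_tent_mul_le lam hn0 t
  have e : cfc (tent lam n) A ψ = cfc (tent lam n) A (ψ - B χ) + (cfc (tent lam n) A * B) χ := by
    rw [mul_apply_eq_comp, map_sub, sub_add_cancel]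
  rw [dist_zero_right, e]
  rw [dist_eq_norm] at hχ
  calc _ ≤ ‖cfc (tent lam n) A (ψ - B χ)‖ + ‖(cfc (tent lam n) A * B) χ‖ := norm_add_le _ _
    _ ≤ 1 * ‖ψ - B χ‖ + 1 / n * ‖χ‖ :=
      add_le_add (ContinuousLinearMap.le_of_opNorm_le _ (norm_cfc_tent_le_one A lam n) _)
        (ContinuousLinearMap.le_of_opNorm_le _ hT _)
    _ < ε / 2 + ε / 2 := by
      refine add_lt_add_of_lt_of_le (by simpa using hχ) ?_
      rw [div_lt_iff₀ (by positivity)] at hN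
      rw [one_div, inv_mul_le_iff₀ hn']
      exact hN.le.trans (by gcongr)
    _ = ε := by ring

lemma tendsto_cfc_tent {A : F →L[ℂ] F} (hA : IsSelfAdjoint A) (lam : ℝ) (ψ : F) :
    Tendsto (fun n : ℕ => cfc (tent lam n) A ψ) atTop (𝓝 ((eigenKer A lam).starProjection ψ)) := by
  have h := tendsto_cfc_tent_orthogonal hA lam
    ((eigenKer A lam).sub_starProjection_mem_orthogonal ψ)
  have h2 := h.const_add ((eigenKer A lam).starProjection ψ)
  rw [add_zero] at h2
  refine h2.congr fun n => ?_
  have h3 := cfc_tent_eigenvector hA lam n ((eigenKer A lam).starProjection_apply_mem ψ)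
  rw [map_sub, h3, add_sub_cancel]

/-- The atom of the spectral measure at `lam` is the squared norm of the projection to the
eigenspace. -/
theorem spectralMeasure_singleton (A : F →L[ℂ] F) (hA : IsSelfAdjoint A) (ψ : F) (lam : ℝ) :
    spectralMeasure A hA ψ {lam}
      = ENNReal.ofReal (‖(eigenKer A lam).starProjection ψ‖ ^ 2) := by
  set μ := spectralMeasure A hA ψ with hμ
  have hfin : IsFiniteMeasureOnCompacts μ := by
    rw [hμ, spectralMeasure]; infer_instance
  -- The index is shifted because `tent lam 0` is the constant `1`, without compact support; `tent
  -- lam 1` will dominate the sequence.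
  have hint : ∀ n : ℕ, ∫ t, tent lam (n + 1) t ∂μ = (⟪ψ, cfc (tent lam (n + 1)) A ψ⟫_ℂ).re :=
    fun n => RealRMK.integral_rieszMeasure (spectralFunctional A hA ψ)
      (tentCc lam (n + 1) n.succ_pos)
  have hlim1 : Tendsto (fun n : ℕ => ∫ t, tent lam (n + 1) t ∂μ) atTop
      (𝓝 (∫ t, ({lam} : Set ℝ).indicator 1 t ∂μ)) := by
    refine tendsto_integral_of_dominated_convergence (tent lam 1)
      (fun n => (continuous_tent _ _).aestronglyMeasurable)
      ((continuous_tent lam 1).integrable_of_hasCompactSupport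
        (tentCc lam 1 one_pos).hasCompactSupport)
      (fun n => .of_forall fun t => ?_) (.of_forall fun t => ?_)
    · rw [Real.norm_of_nonneg (tent_nonneg _ _ _)]
      exact tent_anti lam t (by omega)
    · by_cases h : t = lam
      · subst h; simp [tent_self]
      · have h0 : 0 < |t - lam| := abs_pos.2 (sub_ne_zero.2 h)
        rw [Set.indicator_of_notMem (by simpa using h)]
        obtain ⟨N, hN⟩ := exists_nat_gt (1 / |t - lam|)
        rw [div_lt_iff₀ h0] at hN
        refine tendsto_const_nhds.congr' ?_
        filter_upwards [eventually_ge_atTop N] with n hn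
        refine (tent_eq_zero (hN.le.trans ?_)).symm
        gcongr
        omega
  have hlim2 : Tendsto (fun n : ℕ => (⟪ψ, cfc (tent lam (n + 1)) A ψ⟫_ℂ).re) atTop
      (𝓝 (⟪ψ, (eigenKer A lam).starProjection ψ⟫_ℂ).re) := by
    have h := (tendsto_cfc_tent hA lam ψ).comp (tendsto_add_atTop_nat 1)
    exact (Complex.continuous_re.tendsto _).comp (tendsto_const_nhds.inner h)
  simp only [hint] at hlim1
  have he := tendsto_nhds_unique hlim1 hlim2
  rw [integral_indicator_one (measurableSet_singleton lam)] at he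
  have hr : (⟪ψ, (eigenKer A lam).starProjection ψ⟫_ℂ).re
      = ‖(eigenKer A lam).starProjection ψ‖ ^ 2 := by
    rw [← Submodule.starProjection_eq_self_iff.2 ((eigenKer A lam).starProjection_apply_mem ψ),
      ← Submodule.inner_starProjection_left_eq_right,
      Submodule.starProjection_eq_self_iff.2 ((eigenKer A lam).starProjection_apply_mem ψ)]
    exact inner_self_eq_norm_sq (𝕜 := ℂ) _
  rw [← hr, ← he, Measure.real, ENNReal.ofReal_toReal]
  exact isCompact_singleton.measure_lt_top.ne

end SpectralAtoms

/-! ### Restriction of square-summable functions to subsets. -/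

section Restriction

variable {ι : Type*}

lemma inner_deltaVec (x : ι) (ψ : EllTwo ι) : ⟪(deltaVec x : EllTwo ι), ψ⟫_ℂ = ψ x := by
  classical
  rw [deltaVec, lp.inner_single_left]; simp

lemma deltaVec_self (x : ι) : (deltaVec x : EllTwo ι) x = 1 := by
  classical
  simp [deltaVec]

lemma deltaVec_of_ne {x y : ι} (h : y ≠ x) : (deltaVec x : EllTwo ι) y = 0 := by
  classical
  simp [deltaVec, h]

lemma hasSum_norm_sq (ψ : EllTwo ι) : HasSum (fun z => ‖ψ z‖ ^ 2) (‖ψ‖ ^ 2) := by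
  have := lp.hasSum_norm (p := 2) (by norm_num) ψ
  simpa using this

/-- The restriction of `ψ` to the set `S`, extended by zero. -/
noncomputable def ellTwoRestrict (S : Set ι) (ψ : EllTwo ι) : EllTwo ι :=
  ⟨S.indicator ψ, by
    refine memℓp_gen (Summable.of_nonneg_of_le (fun z => by positivity) (fun z => ?_)
      ((lp.memℓp ψ).summable (by norm_num)))
    gcongr
    exact norm_indicator_le_norm_self _ _⟩

lemma ellTwoRestrict_of_notMem {S : Set ι} (ψ : EllTwo ι) {z : ι} (hz : z ∉ S) :
    ellTwoRestrict S ψ z = 0 := Set.indicator_of_notMem hz _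

lemma ellTwoRestrict_of_mem {S : Set ι} (ψ : EllTwo ι) {z : ι} (hz : z ∈ S) :
    ellTwoRestrict S ψ z = ψ z := Set.indicator_of_mem hz _

lemma ellTwoRestrict_add_compl (S : Set ι) (ψ : EllTwo ι) :
    ellTwoRestrict S ψ + ellTwoRestrict Sᶜ ψ = ψ := by
  ext z
  change ellTwoRestrict S ψ z + ellTwoRestrict Sᶜ ψ z = ψ z
  by_cases hz : z ∈ S
  · rw [ellTwoRestrict_of_mem _ hz, ellTwoRestrict_of_notMem _ (by simpa using hz), add_zero]
  · rw [ellTwoRestrict_of_notMem _ hz, ellTwoRestrict_of_mem _ hz, zero_add]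

lemma ellTwoRestrict_smul (S : Set ι) (c : ℂ) (ψ : EllTwo ι) :
    ellTwoRestrict S (c • ψ) = c • ellTwoRestrict S ψ := by
  ext z
  exact congrFun (Set.indicator_const_smul S c ψ) z

lemma inner_ellTwoRestrict (S : Set ι) (φ ψ : EllTwo ι) :
    ⟪φ, ellTwoRestrict S ψ⟫_ℂ = ⟪ellTwoRestrict S φ, ellTwoRestrict S ψ⟫_ℂ := by
  rw [lp.inner_eq_tsum, lp.inner_eq_tsum]
  refine tsum_congr fun z => ?_
  by_cases hz : z ∈ S
  · simp only [ellTwoRestrict_of_mem _ hz]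
  · simp only [ellTwoRestrict_of_notMem _ hz, inner_zero_right]

lemma hasSum_ellTwoRestrict (S : Set ι) (ψ : EllTwo ι) :
    HasSum (S.indicator fun z => ‖ψ z‖ ^ 2) (‖ellTwoRestrict S ψ‖ ^ 2) := by
  refine (hasSum_norm_sq (ellTwoRestrict S ψ)).congr_fun fun z => ?_
  by_cases hz : z ∈ S
  · rw [ellTwoRestrict_of_mem _ hz, Set.indicator_of_mem hz]
  · rw [ellTwoRestrict_of_notMem _ hz, Set.indicator_of_notMem hz]; simp

lemma norm_sq_restrict_add_compl (S : Set ι) (ψ : EllTwo ι) :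
    ‖ellTwoRestrict S ψ‖ ^ 2 + ‖ellTwoRestrict Sᶜ ψ‖ ^ 2 = ‖ψ‖ ^ 2 := by
  have h := (hasSum_ellTwoRestrict S ψ).add (hasSum_ellTwoRestrict Sᶜ ψ)
  refine h.unique ((hasSum_norm_sq ψ).congr_fun fun z => ?_)
  exact congrFun (Set.indicator_self_add_compl S fun z => ‖ψ z‖ ^ 2) z

/-- If the sets `S d` partition the complement of `x`, the masses of `ψ` on them add up. -/
lemma sum_norm_sq_restrict_of_partition {D : Type*} [Fintype D] (S : D → Set ι) (x : ι)
    (hx : ∀ d, x ∉ S d) (hS : ∀ z, z ≠ x → ∃! d, z ∈ S d) (ψ : EllTwo ι) :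
    ∑ d, ‖ellTwoRestrict (S d) ψ‖ ^ 2 = ‖ψ‖ ^ 2 - ‖ψ x‖ ^ 2 := by
  classical
  have h := hasSum_sum fun d (_ : d ∈ Finset.univ) => hasSum_ellTwoRestrict (S d) ψ
  have h2 := (hasSum_norm_sq ψ).sub (hasSum_ite_eq x (‖ψ x‖ ^ 2))
  refine h.unique (h2.congr_fun fun z => ?_)
  by_cases hz : z = x
  · subst hz
    simp [hx]
  · obtain ⟨d, hd, hu⟩ := hS z hz
    rw [if_neg hz, sub_zero, Finset.sum_eq_single d]
    · exact Set.indicator_of_mem hd _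
    · exact fun d' _ h' => Set.indicator_of_notMem (fun h'' => h' (hu d' h'')) _
    · simp

end Restriction

/-! ### Eigenfunctions and cut edges -/

section Cut

variable {ι : Type*}

/-- `S` contains `y` but not `x`, and no entry of `M` other than the one between `y` and `x` links
`S` to its complement. -/
structure IsCut (M : ι → ι → ℝ) (x y : ι) (S : Set ι) : Prop where
  notMem : x ∉ S
  mem : y ∈ S
  crossing : ∀ z ∈ S, ∀ w, w ∉ S → M z w ≠ 0 → z = y ∧ w = x

lemma IsCut.ne {M : ι → ι → ℝ} {x y : ι} {S : Set ι} (h : IsCut M x y S) : x ≠ y := by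
  rintro rfl
  exact h.notMem h.mem

variable {M : ι → ι → ℝ} {C : ℝ≥0} (hM : IsSchurBounded M C) (lam : ℝ)

/-- The projection of `δ_x` to the eigenspace of `M` at `lam`. -/
noncomputable def eigenColumn (x : ι) : EllTwo ι :=
  (eigenKer (matrixOperator M hM) lam).starProjection (deltaVec x)

lemma eigenColumn_mem (x : ι) : eigenColumn hM lam x ∈ eigenKer (matrixOperator M hM) lam :=
  Submodule.starProjection_apply_mem _ _

variable {hM lam}

/-- The columns are the reproducing kernel of the eigenspace: pairing with `p_x` is evaluation at
`x`. -/
lemma inner_eigenColumn {χ : EllTwo ι} (hχ : χ ∈ eigenKer (matrixOperator M hM) lam) (x : ι) :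
    ⟪eigenColumn hM lam x, χ⟫_ℂ = χ x := by
  rw [eigenColumn, Submodule.inner_starProjection_left_eq_right,
    Submodule.starProjection_eq_self_iff.2 hχ, inner_deltaVec]

lemma eigenColumn_unique {x : ι} {q : EllTwo ι} (hq : q ∈ eigenKer (matrixOperator M hM) lam)
    (h : ∀ χ ∈ eigenKer (matrixOperator M hM) lam, ⟪q, χ⟫_ℂ = χ x) : q = eigenColumn hM lam x := by
  rw [← sub_eq_zero, ← inner_self_eq_zero (𝕜 := ℂ)]
  have hm := Submodule.sub_mem _ hq (eigenColumn_mem hM lam x)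
  rw [inner_sub_left, h _ hm, inner_eigenColumn hm, sub_self]

lemma eigenColumn_self (x : ι) : eigenColumn hM lam x x
    = ((‖eigenColumn hM lam x‖ ^ 2 : ℝ) : ℂ) := by
  rw [← inner_eigenColumn (eigenColumn_mem hM lam x), inner_self_eq_norm_sq_to_K]
  norm_cast

lemma eq_zero_of_eigenColumn_eq_zero {χ : EllTwo ι}
    (hχ : χ ∈ eigenKer (matrixOperator M hM) lam) {x : ι} (hx : eigenColumn hM lam x = 0) :
    χ x = 0 := by
  rw [← inner_eigenColumn hχ, hx, inner_zero_left]

lemma eigenColumn_ne_zero_iff {x : ι} : eigenColumn hM lam x ≠ 0 ↔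
    ∃ χ ∈ eigenKer (matrixOperator M hM) lam, χ x ≠ 0 := by
  refine ⟨fun h => ⟨_, eigenColumn_mem hM lam x, ?_⟩, fun ⟨χ, hχ, h⟩ h0 =>
    h (eq_zero_of_eigenColumn_eq_zero hχ h0)⟩
  rw [eigenColumn_self]
  simpa using h

/-- The commutator of `M` with the indicator of `S` has nonzero entries at most at `(x, y)` and `(y,
x)`. Applied to an eigenfunction it leaves only these two boundary terms. -/
lemma matrixOperator_restrict_eigenvector {x y : ι} {S : Set ι} (hS : IsCut M x y S) {ψ : EllTwo ι}
    (hψ : ψ ∈ eigenKer (matrixOperator M hM) lam) :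
    matrixOperator M hM (ellTwoRestrict S ψ) - (lam : ℂ) • ellTwoRestrict S ψ
      = (M x y : ℂ) • (ψ y • deltaVec x - ψ x • deltaVec y) := by
  classical
  have hd : ∀ u v : ι, (deltaVec u : EllTwo ι) v = if v = u then 1 else 0 := fun u v => by
    by_cases h : v = u
    · subst h; simp [deltaVec_self]
    · simp [deltaVec_of_ne h, h]
  have hne := hS.ne
  ext z
  have hsum : HasSum (fun w => (M z w : ℂ) * ψ w) (matrixOperator M hM ψ z) :=
    (schur_summable hM ψ z).hasSum
  have h1 := hsum.mul_left (S.indicator (fun _ => (1 : ℂ)) z)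
  -- Row `z` of the commutator: a term at `w = y` is gained if `z = x`, and one at `w = x` is lost
  -- if `z = y`.
  have h2 := (h1.add (hasSum_ite_eq y (if z = x then (M x y : ℂ) * ψ y else 0))).sub
    (hasSum_ite_eq x (if z = y then (M x y : ℂ) * ψ x else 0))
  have h3 : matrixOperator M hM (ellTwoRestrict S ψ) z
      = S.indicator (fun _ => (1 : ℂ)) z * matrixOperator M hM ψ z
        + (if z = x then (M x y : ℂ) * ψ y else 0) - (if z = y then (M x y : ℂ) * ψ x else 0) := by
    rw [matrixOperator_apply, ← h2.tsum_eq]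
    refine tsum_congr fun w => ?_
    by_cases hz : z ∈ S <;> by_cases hw : w ∈ S
    · have hzx : z ≠ x := fun h => hS.notMem (h ▸ hz)
      have hwx : w ≠ x := fun h => hS.notMem (h ▸ hw)
      simp [ellTwoRestrict_of_mem _ hw, hz, hzx, hwx]
    · have hzx : z ≠ x := fun h => hS.notMem (h ▸ hz)
      have hwy : w ≠ y := fun h => hw (h ▸ hS.mem)
      rw [ellTwoRestrict_of_notMem _ hw]
      by_cases hm : M z w = 0
      · by_cases hzy : z = y
        · by_cases hwx : w = x
          · subst hzy hwx
            simp [hm, hM.symm w z]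
          · simp [hm, hwx, hzx]
        · simp [hm, hzx, hzy]
      · obtain ⟨rfl, rfl⟩ := hS.crossing z hz w hw hm
        simp [hz, hne, hM.symm w z]
    · have hzy : z ≠ y := fun h => hz (h ▸ hS.mem)
      have hwx : w ≠ x := fun h => hS.notMem (h ▸ hw)
      rw [ellTwoRestrict_of_mem _ hw]
      by_cases hm : M w z = 0
      · have hm' : M z w = 0 := (hM.symm z w).trans hm
        by_cases hzx : z = x
        · by_cases hwy : w = y
          · subst hzx hwy
            simp [hm', hne]
          · simp [hm', hwy, hwx]
        · simp [hm', hzx, hzy]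
      · obtain ⟨rfl, rfl⟩ := hS.crossing w hw z hz hm
        simp [hz, hne.symm]
    · have hwy : w ≠ y := fun h => hw (h ▸ hS.mem)
      have hzy : z ≠ y := fun h => hz (h ▸ hS.mem)
      simp [ellTwoRestrict_of_notMem _ hw, hz, hwy, hzy]
  have h4 : matrixOperator M hM ψ z = lam * ψ z := by
    rw [mem_eigenKer.1 hψ]; rfl
  change matrixOperator M hM (ellTwoRestrict S ψ) z - (lam : ℂ) * ellTwoRestrict S ψ z
    = (M x y : ℂ) * (ψ y * (deltaVec x : EllTwo ι) z - ψ x * (deltaVec y : EllTwo ι) z)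
  rw [h3, h4, hd, hd]
  by_cases hz : z ∈ S
  · rw [ellTwoRestrict_of_mem _ hz, Set.indicator_of_mem hz]
    split_ifs <;> ring
  · rw [ellTwoRestrict_of_notMem _ hz, Set.indicator_of_notMem hz]
    split_ifs <;> ring

lemma inner_eigenvector_sub_smul {χ : EllTwo ι} (hχ : χ ∈ eigenKer (matrixOperator M hM) lam)
    (u : EllTwo ι) : ⟪χ, matrixOperator M hM u - (lam : ℂ) • u⟫_ℂ = 0 := by
  have h := (matrixOperator_isSelfAdjoint M hM).isSymmetric χ u
  rw [ContinuousLinearMap.coe_coe, mem_eigenKer.1 hχ, inner_smul_left] at h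
  rw [inner_sub_right, inner_smul_right, ← h]
  simp

lemma inner_deltaVec_right (x : ι) (ψ : EllTwo ι) :
    ⟪ψ, (deltaVec x : EllTwo ι)⟫_ℂ = starRingEnd ℂ (ψ x) := by
  rw [← inner_conj_symm, inner_deltaVec]

/-- The Wronskian of two eigenfunctions across a cut edge vanishes. -/
lemma eigenvector_cross {x y : ι} {S : Set ι} (hS : IsCut M x y S) (hxy : M x y ≠ 0)
    {ψ χ : EllTwo ι} (hψ : ψ ∈ eigenKer (matrixOperator M hM) lam)
    (hχ : χ ∈ eigenKer (matrixOperator M hM) lam) :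
    ψ y * starRingEnd ℂ (χ x) = ψ x * starRingEnd ℂ (χ y) := by
  have h := inner_eigenvector_sub_smul hχ (ellTwoRestrict S ψ)
  rw [matrixOperator_restrict_eigenvector hS hψ, inner_smul_right, inner_sub_right,
    inner_smul_right, inner_smul_right, inner_deltaVec_right, inner_deltaVec_right] at h
  have hxy' : (M x y : ℂ) ≠ 0 := by exact_mod_cast hxy
  exact sub_eq_zero.1 ((mul_eq_zero.1 h).resolve_left hxy')

/-- The difference of the two sides lies in the eigenspace and, by `eigenvector_cross`, pairs to
zero with every eigenfunction, hence with itself. -/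
lemma eigenColumn_proportional {x y : ι} {S : Set ι} (hS : IsCut M x y S) (hxy : M x y ≠ 0) :
    eigenColumn hM lam x x • eigenColumn hM lam y
      = eigenColumn hM lam x y • eigenColumn hM lam x := by
  have hx := eigenColumn_mem hM lam x
  have hy := eigenColumn_mem hM lam y
  rw [← sub_eq_zero, ← inner_self_eq_zero (𝕜 := ℂ)]
  have key : ∀ χ ∈ eigenKer (matrixOperator M hM) lam,
      ⟪eigenColumn hM lam x x • eigenColumn hM lam y
        - eigenColumn hM lam x y • eigenColumn hM lam x, χ⟫_ℂ = 0 := fun χ hχ => by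
    rw [inner_sub_left, inner_smul_left, inner_smul_left, inner_eigenColumn hχ,
      inner_eigenColumn hχ, mul_comm, mul_comm (starRingEnd ℂ _),
      eigenvector_cross hS hxy hχ hx, sub_self]
  exact key _ (Submodule.sub_mem _ (Submodule.smul_mem _ _ hy) (Submodule.smul_mem _ _ hx))

variable (hM lam) in
/-- The fraction of the squared norm of the eigenfunction `eigenColumn x` carried by `S`. -/
noncomputable def massFraction (x : ι) (S : Set ι) : ℝ :=
  ‖ellTwoRestrict S (eigenColumn hM lam x)‖ ^ 2 / ‖eigenColumn hM lam x‖ ^ 2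

/-- Proportional columns put the same fraction of their mass on `S`, so the fractions on `S` and
`Sᶜ` may be computed from one column. -/
lemma massFraction_add_compl {x y : ι} {S : Set ι} (hS : IsCut M x y S) (hxy : M x y ≠ 0)
    (hx : eigenColumn hM lam x ≠ 0) (hy : eigenColumn hM lam y ≠ 0) :
    massFraction hM lam x S + massFraction hM lam y Sᶜ = 1 := by
  have hxx : eigenColumn hM lam x x ≠ 0 := by rw [eigenColumn_self]; simpa using hx
  have hp := eigenColumn_proportional (hM := hM) (lam := lam) hS hxy
  set c := eigenColumn hM lam x y / eigenColumn hM lam x x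
  have hc : eigenColumn hM lam y = c • eigenColumn hM lam x := by
    rw [← inv_smul_smul₀ hxx (eigenColumn hM lam y), hp, smul_smul]
    congr 1
    exact inv_mul_eq_div _ _
  have hc0 : c ≠ 0 := by
    rintro h0
    rw [h0, zero_smul] at hc
    exact hy hc
  have hx' : ‖eigenColumn hM lam x‖ ≠ 0 := norm_ne_zero_iff.2 hx
  have hc' : ‖c‖ ≠ 0 := norm_ne_zero_iff.2 hc0
  rw [massFraction, massFraction, hc, ellTwoRestrict_smul, norm_smul, norm_smul, mul_pow, mul_pow,
    mul_div_mul_left _ _ (pow_ne_zero 2 hc'), ← add_div, norm_sq_restrict_add_compl,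
    div_self (pow_ne_zero 2 hx')]

/-- The fraction left over at `x` is `|p_x(x)|² / ‖p_x‖²`, which is `‖p_x‖²` because `p_x(x) =
‖p_x‖²`. -/
lemma sum_massFraction_of_partition {D : Type*} [Fintype D] (S : D → Set ι) (x : ι)
    (hx : ∀ d, x ∉ S d) (hS : ∀ z, z ≠ x → ∃! d, z ∈ S d) (h0 : eigenColumn hM lam x ≠ 0) :
    ∑ d, massFraction hM lam x (S d) = 1 - ‖eigenColumn hM lam x‖ ^ 2 := by
  have hx' : ‖eigenColumn hM lam x‖ ≠ 0 := norm_ne_zero_iff.2 h0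
  simp only [massFraction]
  rw [← Finset.sum_div, sum_norm_sq_restrict_of_partition S x hx hS, eigenColumn_self,
    Complex.norm_real, Real.norm_of_nonneg (by positivity)]
  field_simp

/-- A vertex `y` at which all eigenfunctions vanish is in the range of `M - lam` as soon as some
eigenfunction does not vanish at a neighbor of `y` on the other side of a cut edge; the preimage
orthogonal to the eigenspace is given at such neighbors by the mass fractions. -/
lemma exists_preimage_deltaVec {x₀ y : ι} {S₀ : Set ι} (hS₀ : IsCut M x₀ y S₀) (hxy₀ : M x₀ y ≠ 0)
    (hx₀ : eigenColumn hM lam x₀ ≠ 0) (hy : eigenColumn hM lam y = 0) :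
    ∃ w : EllTwo ι, matrixOperator M hM w - (lam : ℂ) • w = deltaVec y ∧ w y = 0 ∧
      (∀ z, eigenColumn hM lam z = 0 → w z = 0) ∧
      ∀ x S, IsCut M x y S → M x y ≠ 0 → eigenColumn hM lam x ≠ 0 →
        (M x y : ℂ) * w x = (massFraction hM lam x S : ℂ) := by
  set K := eigenKer (matrixOperator M hM) lam with hK
  -- Each neighbor `x` produces its own preimage; orthogonality to `K` is recorded so that all of
  -- them can be identified at the end.
  have key : ∀ x S, IsCut M x y S → M x y ≠ 0 → eigenColumn hM lam x ≠ 0 →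
      ∃ w : EllTwo ι, matrixOperator M hM w - (lam : ℂ) • w = deltaVec y ∧ w ∈ Kᗮ ∧
        (∀ z, eigenColumn hM lam z = 0 → w z = 0) ∧
        (M x y : ℂ) * w x = (massFraction hM lam x S : ℂ) := by
    intro x S hS hxy hx
    have hp := eigenColumn_mem hM lam x
    set p := eigenColumn hM lam x with hpdef
    have hpy : p y = 0 := eq_zero_of_eigenColumn_eq_zero hp hy
    have hpx : p x = ((‖p‖ ^ 2 : ℝ) : ℂ) := eigenColumn_self x
    -- Since `p y = 0`, cutting `p` at the edge spoils the eigenvalue equation at `y` only.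
    set u := ellTwoRestrict Sᶜ p with hu
    have hHu : matrixOperator M hM u - (lam : ℂ) • u
        = ((M x y : ℂ) * p x) • (deltaVec y : EllTwo ι) := by
      have h1 := matrixOperator_restrict_eigenvector hS hp
      have h2 : u = p - ellTwoRestrict S p := by
        rw [eq_sub_iff_add_eq, add_comm, hu, ellTwoRestrict_add_compl]
      have h3 : matrixOperator M hM u - (lam : ℂ) • u
          = -(matrixOperator M hM (ellTwoRestrict S p) - (lam : ℂ) • ellTwoRestrict S p) := by
        rw [h2, map_sub, mem_eigenKer.1 hp, smul_sub]; abel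
      rw [h3, h1, hpy, zero_smul, zero_sub, smul_neg, neg_neg, smul_smul]
    have hc : (M x y : ℂ) * p x ≠ 0 := by
      refine mul_ne_zero (by exact_mod_cast hxy) ?_
      rw [hpx]; simpa using hx
    set c := (M x y : ℂ) * p x with hcdef
    have hPu := K.starProjection_apply_mem u
    refine ⟨c⁻¹ • (u - K.starProjection u), ?_, ?_, ?_, ?_⟩
    · have h4 : matrixOperator M hM (u - K.starProjection u) - (lam : ℂ) • (u - K.starProjection u)
          = c • deltaVec y := by
        rw [← hHu, map_sub, mem_eigenKer.1 hPu, smul_sub]; abel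
      rw [map_smul, smul_comm, ← smul_sub, h4, inv_smul_smul₀ hc]
    · exact Submodule.smul_mem _ _ (K.sub_starProjection_mem_orthogonal u)
    · intro z hz
      change c⁻¹ * (u z - K.starProjection u z) = 0
      have h5 : p z = 0 := eq_zero_of_eigenColumn_eq_zero hp hz
      have h6 : u z = 0 := by
        by_cases hzS : z ∈ Sᶜ
        · rw [hu, ellTwoRestrict_of_mem _ hzS, h5]
        · rw [hu, ellTwoRestrict_of_notMem _ hzS]
      rw [eq_zero_of_eigenColumn_eq_zero hPu hz, h6]; simp
    · change (M x y : ℂ) * (c⁻¹ * (u x - K.starProjection u x)) = _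
      -- Reproducing property: `(P u)(x) = ⟪p, P u⟫ = ⟪p, u⟫ = ‖u‖²`.
      have h7 : K.starProjection u x = ((‖u‖ ^ 2 : ℝ) : ℂ) := by
        rw [← inner_eigenColumn hPu, ← Submodule.inner_starProjection_left_eq_right,
          Submodule.starProjection_eq_self_iff.2 hp, hu, inner_ellTwoRestrict,
          inner_self_eq_norm_sq_to_K]
        norm_cast
      have h8 : u x = p x := ellTwoRestrict_of_mem _ hS.notMem
      have h9 : ‖p‖ ^ 2 - ‖u‖ ^ 2 = ‖ellTwoRestrict S p‖ ^ 2 := by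
        rw [← norm_sq_restrict_add_compl S p]; ring
      have hpn : (‖p‖ : ℂ) ≠ 0 := by exact_mod_cast norm_ne_zero_iff.2 hx
      have hM0 : (M x y : ℂ) ≠ 0 := by exact_mod_cast hxy
      rw [h7, h8, hcdef, hpx, massFraction, ← hpdef, ← h9]
      push_cast
      field_simp
  obtain ⟨w, hw1, hw2, hw3, -⟩ := key x₀ S₀ hS₀ hxy₀ hx₀
  refine ⟨w, hw1, hw3 y hy, hw3, fun x S hS hxy hx => ?_⟩
  obtain ⟨w', hw1', hw2', -, hw4'⟩ := key x S hS hxy hx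
  -- Two preimages of `δ_y` in `Kᗮ` differ by an element of `K ∩ Kᗮ`, so one `w` serves all
  -- neighbors.
  have hww : w - w' = 0 := by
    have h1 : w - w' ∈ K := by
      rw [hK, mem_eigenKer, ← sub_eq_zero, map_sub, smul_sub]
      have : matrixOperator M hM w - matrixOperator M hM w' - ((lam : ℂ) • w - (lam : ℂ) • w')
          = (matrixOperator M hM w - (lam : ℂ) • w) - (matrixOperator M hM w' - (lam : ℂ) • w') := by
        abel
      rw [this, hw1, hw1', sub_self]
    have h2 : w - w' ∈ Kᗮ := Submodule.sub_mem _ hw2 hw2'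
    exact inner_self_eq_zero.1 (h2 _ h1)
  rw [sub_eq_zero.1 hww, hw4']

end Cut

/-! ### Symmetries of the matrix -/

section Symmetry

variable {ι : Type*}

/-- The composition of a square-summable function with a permutation. -/
noncomputable def ellTwoComp (φ : ι ≃ ι) (ψ : EllTwo ι) : EllTwo ι :=
  ⟨fun z => ψ (φ z), memℓp_gen (((lp.memℓp ψ).summable (by norm_num)).comp_injective φ.injective)⟩

lemma ellTwoComp_apply (φ : ι ≃ ι) (ψ : EllTwo ι) (z : ι) : ellTwoComp φ ψ z = ψ (φ z) := rfl

lemma inner_ellTwoComp (φ : ι ≃ ι) (ψ χ : EllTwo ι) :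
    ⟪ellTwoComp φ ψ, χ⟫_ℂ = ⟪ψ, ellTwoComp φ.symm χ⟫_ℂ := by
  rw [lp.inner_eq_tsum, lp.inner_eq_tsum,
    ← φ.tsum_eq fun z => ⟪ψ z, (ellTwoComp φ.symm χ) z⟫_ℂ]
  refine tsum_congr fun z => ?_
  rw [ellTwoComp_apply, ellTwoComp_apply, φ.symm_apply_apply]

lemma norm_sq_restrict_ellTwoComp (φ : ι ≃ ι) (ψ : EllTwo ι) {S S' : Set ι}
    (h : ∀ z, φ z ∈ S' ↔ z ∈ S) :
    ‖ellTwoRestrict S (ellTwoComp φ ψ)‖ ^ 2 = ‖ellTwoRestrict S' ψ‖ ^ 2 := by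
  rw [← (hasSum_ellTwoRestrict S (ellTwoComp φ ψ)).tsum_eq, ← (hasSum_ellTwoRestrict S' ψ).tsum_eq,
    ← φ.tsum_eq (S'.indicator _)]
  refine tsum_congr fun z => ?_
  classical
  simp only [Set.indicator_apply, h, ellTwoComp_apply]

lemma norm_sq_ellTwoComp (φ : ι ≃ ι) (ψ : EllTwo ι) : ‖ellTwoComp φ ψ‖ ^ 2 = ‖ψ‖ ^ 2 := by
  rw [← (hasSum_norm_sq ψ).tsum_eq, ← (hasSum_norm_sq _).tsum_eq]
  exact φ.tsum_eq fun z => ‖ψ z‖ ^ 2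

variable {M : ι → ι → ℝ} {C : ℝ≥0} {hM : IsSchurBounded M C} {lam : ℝ}

lemma ellTwoComp_mem_eigenKer {φ : ι ≃ ι} (hφ : ∀ z w, M (φ z) (φ w) = M z w) {ψ : EllTwo ι}
    (hψ : ψ ∈ eigenKer (matrixOperator M hM) lam) :
    ellTwoComp φ ψ ∈ eigenKer (matrixOperator M hM) lam := by
  rw [mem_eigenKer] at hψ ⊢
  ext z
  have h : matrixOperator M hM ψ (φ z) = lam * ψ (φ z) := by rw [hψ]; rfl
  change matrixOperator M hM (ellTwoComp φ ψ) z = lam * ψ (φ z)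
  rw [← h, matrixOperator_apply, matrixOperator_apply,
    ← φ.tsum_eq fun w => (M (φ z) w : ℂ) * ψ w]
  exact tsum_congr fun w => by rw [hφ, ellTwoComp_apply]

/-- Pulling back along a symmetry preserves the eigenspace, and the pulled-back column still
reproduces evaluation at `x`; `eigenColumn_unique` concludes. -/
lemma eigenColumn_symmetry {φ : ι ≃ ι} (hφ : ∀ z w, M (φ z) (φ w) = M z w) (x : ι) :
    ellTwoComp φ (eigenColumn hM lam (φ x)) = eigenColumn hM lam x := by
  refine eigenColumn_unique (ellTwoComp_mem_eigenKer hφ (eigenColumn_mem hM lam _)) fun χ hχ => ?_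
  have hφ' : ∀ z w, M (φ.symm z) (φ.symm w) = M z w := fun z w => by
    rw [← hφ, φ.apply_symm_apply, φ.apply_symm_apply]
  rw [inner_ellTwoComp, inner_eigenColumn (ellTwoComp_mem_eigenKer hφ' hχ), ellTwoComp_apply,
    φ.symm_apply_apply]

lemma norm_sq_eigenColumn_symmetry {φ : ι ≃ ι} (hφ : ∀ z w, M (φ z) (φ w) = M z w) (x : ι) :
    ‖eigenColumn hM lam (φ x)‖ ^ 2 = ‖eigenColumn hM lam x‖ ^ 2 := by
  rw [← eigenColumn_symmetry hφ x, norm_sq_ellTwoComp]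

lemma massFraction_symmetry {φ : ι ≃ ι} (hφ : ∀ z w, M (φ z) (φ w) = M z w) (x : ι) {S S' : Set ι}
    (h : ∀ z, φ z ∈ S' ↔ z ∈ S) : massFraction hM lam (φ x) S' = massFraction hM lam x S := by
  rw [massFraction, massFraction, ← eigenColumn_symmetry hφ x, norm_sq_ellTwoComp,
    norm_sq_restrict_ellTwoComp φ _ h]

end Symmetry

/-! ### The universal cover inside the free group on the edges -/

namespace Multigraph

variable {V E : Type*}

lemma init_rev (G : Multigraph V E) (d : Dart E) : G.init (rev d) = G.term d := by
  rcases d with ⟨e, _ | _⟩ <;> rfl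

lemma term_rev (G : Multigraph V E) (d : Dart E) : G.term (rev d) = G.init d := by
  rcases d with ⟨e, _ | _⟩ <;> rfl

lemma ne_rev_iff (d d' : Dart E) : d ≠ rev d' ↔ (d.1 = d'.1 → d.2 = d'.2) := by
  rcases d with ⟨e, b⟩
  rcases d' with ⟨e', b'⟩
  cases b <;> cases b' <;> simp [rev]

lemma mk_rev (d : Dart E) : FreeGroup.mk [rev d] = (FreeGroup.mk [d])⁻¹ := by
  rw [FreeGroup.inv_mk]; rfl

/-- The list of oriented edges (last edge first) is a walk from `u` to `v`. -/
def IsWalk (G : Multigraph V E) (u : V) : V → List (Dart E) → Prop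
  | v, [] => u = v
  | v, d :: w => G.term d = v ∧ G.IsWalk u (G.init d) w

variable {G : Multigraph V E} {u v m v₀ : V}

lemma IsWalk.endpoint_eq {w : List (Dart E)} (h : G.IsWalk u v w) : G.endpoint u w = v := by
  cases w with
  | nil => exact h
  | cons d w => exact h.1

lemma isWalk_append {L L' : List (Dart E)} :
    G.IsWalk u v (L ++ L') ↔ ∃ m, G.IsWalk u m L' ∧ G.IsWalk m v L := by
  induction L generalizing v with
  | nil => simp [IsWalk]
  | cons d L ih =>
    simp only [List.cons_append, IsWalk, ih]
    exact ⟨fun ⟨h, m, h1, h2⟩ => ⟨m, h1, h, h2⟩, fun ⟨m, h1, h, h2⟩ => ⟨h, m, h1, h2⟩⟩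

lemma isWalk_singleton {d : Dart E} : G.IsWalk u v [d] ↔ G.term d = v ∧ u = G.init d := Iff.rfl

/-- A cancelled pair of letters is an edge and its reverse, a detour that returns to where it began,
so the ends of the walk survive. -/
lemma IsWalk.step {L L' : List (Dart E)} (h : G.IsWalk u v L) (hs : FreeGroup.Red.Step L L') :
    G.IsWalk u v L' := by
  obtain @⟨L₁, L₂, e, b⟩ := hs
  rw [isWalk_append] at h ⊢
  obtain ⟨m, h2, h1⟩ := h
  refine ⟨m, ?_, h1⟩
  have h3 : G.init (e, !b) = m := (G.init_rev (e, b)).trans h2.1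
  rw [← h3]
  exact h2.2.2

lemma IsWalk.red {L L' : List (Dart E)} (h : G.IsWalk u v L) (hs : FreeGroup.Red L L') :
    G.IsWalk u v L' := by
  induction hs with
  | refl => exact h
  | tail _ hs ih => exact ih.step hs

lemma IsWalk.invRev {L : List (Dart E)} (h : G.IsWalk u v L) :
    G.IsWalk v u (FreeGroup.invRev L) := by
  induction L generalizing v with
  | nil => exact (show u = v from h).symm
  | cons d L ih =>
    have e : FreeGroup.invRev (d :: L) = FreeGroup.invRev L ++ [rev d] := by
      simp [FreeGroup.invRev, rev]
    rw [e, isWalk_append]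
    refine ⟨G.init d, ⟨G.term_rev d, ?_⟩, ih h.2⟩
    change v = _
    rw [init_rev]
    exact h.1.symm

/-- Oriented edges are the letters of the free group on `E`, with `rev` as inversion. The walk
condition and the reducedness of the word separate, which makes group calculations available for the
cover. -/
lemma isReducedWalk_iff {w : List (Dart E)} :
    G.IsReducedWalk v₀ w ↔ G.IsWalk v₀ (G.endpoint v₀ w) w ∧ FreeGroup.IsReduced w := by
  induction w with
  | nil => exact ⟨fun _ => ⟨rfl, .nil⟩, fun _ => trivial⟩
  | cons d w ih =>
    have hred : FreeGroup.IsReduced (d :: w) ↔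
        (∀ d' ∈ w.head?, d ≠ rev d') ∧ FreeGroup.IsReduced w := by
      cases w with
      | nil => simp [FreeGroup.IsReduced.nil, FreeGroup.IsReduced.singleton]
      | cons d' w =>
        rw [FreeGroup.isReduced_cons_cons, ← ne_rev_iff]
        simp
    rw [hred]
    change (_ ∧ _ ∧ _) ↔ (_ ∧ _) ∧ _
    rw [ih]
    constructor
    · rintro ⟨h1, h2, h3, h4⟩
      exact ⟨⟨rfl, h1 ▸ h3⟩, h2, h4⟩
    · rintro ⟨⟨-, h1⟩, h2, h4⟩
      have h := h1.endpoint_eq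
      exact ⟨h.symm, h2, h ▸ h1, h4⟩

/-- The element of the free group on the edges that is given by a reduced walk. -/
def toFree (x : G.Cover v₀) : FreeGroup E := FreeGroup.mk x.1

lemma isWalk_cover (x : G.Cover v₀) : G.IsWalk v₀ (G.proj v₀ x) x.1 :=
  (isReducedWalk_iff.1 x.2).1

lemma IsLift.proj_left {d : Dart E} {x y : G.Cover v₀} (h : G.IsLift v₀ d x y) :
    G.proj v₀ x = G.init d := by
  have hy := isWalk_cover y
  have hx := isWalk_cover x
  rcases h with h | h
  · rw [h] at hy
    exact hx.endpoint_eq.symm.trans hy.2.endpoint_eq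
  · rw [h] at hx
    rw [← hx.1, term_rev]

lemma IsLift.proj_right {d : Dart E} {x y : G.Cover v₀} (h : G.IsLift v₀ d x y) :
    G.proj v₀ y = G.term d := by
  rw [((G.isLift_rev v₀ d y x).2 h).proj_left, init_rev]

lemma IsLift.ne {d : Dart E} {x y : G.Cover v₀} (h : G.IsLift v₀ d x y) : x ≠ y := by
  rintro rfl
  rcases h with h | h <;> simpa using congrArg List.length h

lemma exists_isLift_of_jacobiMatrix_ne_zero [Fintype E] (J : JacobiParameters V E)
    {x y : G.Cover v₀} (hxy : x ≠ y)
    (h : G.jacobiMatrix J v₀ x y ≠ 0) : ∃ d, G.IsLift v₀ d x y := by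
  rw [jacobiMatrix, if_neg hxy] at h
  obtain ⟨d, -, hd⟩ := Finset.exists_ne_zero_of_sum_ne_zero h
  by_contra! hc
  exact hd (if_neg (hc d))

variable [DecidableEq E]

lemma toWord_toFree (x : G.Cover v₀) : (toFree x).toWord = x.1 :=
  (isReducedWalk_iff.1 x.2).2.reduce_eq

lemma toFree_injective : Function.Injective (toFree : G.Cover v₀ → FreeGroup E) := fun x y h =>
  Subtype.ext (by rw [← toWord_toFree, h, toWord_toFree])

lemma toWord_mk_singleton (d : Dart E) : (FreeGroup.mk [d]).toWord = [d] := rfl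

lemma mk_singleton_injective : Function.Injective fun d : Dart E => FreeGroup.mk [d] :=
  fun d d' h => by
    have := congrArg FreeGroup.toWord h
    simpa [toWord_mk_singleton] using this

/-- The reduced word of the element `g` of the free group is a walk from `u` to `v`. -/
def Joins (G : Multigraph V E) (u v : V) (g : FreeGroup E) : Prop := G.IsWalk u v g.toWord

lemma IsWalk.joins {L : List (Dart E)} (h : G.IsWalk u v L) : G.Joins u v (FreeGroup.mk L) :=
  h.red FreeGroup.reduce.red

lemma Joins.mul {g h : FreeGroup E} (hg : G.Joins m v g) (hh : G.Joins u m h) :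
    G.Joins u v (g * h) := by
  rw [← FreeGroup.mk_toWord (x := g), ← FreeGroup.mk_toWord (x := h), FreeGroup.mul_mk]
  exact (isWalk_append.2 ⟨m, hh, hg⟩).joins

lemma Joins.inv {g : FreeGroup E} (hg : G.Joins u v g) : G.Joins v u g⁻¹ := by
  rw [Joins, FreeGroup.toWord_inv]
  exact IsWalk.invRev hg

lemma joins_toFree (x : G.Cover v₀) : G.Joins v₀ (G.proj v₀ x) (toFree x) := (isWalk_cover x).joins

lemma joins_dart (d : Dart E) : G.Joins (G.init d) (G.term d) (FreeGroup.mk [d]) :=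
  (isWalk_singleton.2 ⟨rfl, rfl⟩ : G.IsWalk _ _ [d]).joins

/-- The vertex of the universal cover given by an element of the free group. -/
def ofFree (g : FreeGroup E) (h : G.Joins v₀ v g) : G.Cover v₀ :=
  ⟨g.toWord, isReducedWalk_iff.2 ⟨by rw [h.endpoint_eq]; exact h, FreeGroup.isReduced_toWord⟩⟩

lemma toFree_ofFree (g : FreeGroup E) (h : G.Joins v₀ v g) : toFree (ofFree g h) = g :=
  FreeGroup.mk_toWord

lemma proj_ofFree (g : FreeGroup E) (h : G.Joins v₀ v g) : G.proj v₀ (ofFree g h) = v :=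
  h.endpoint_eq

lemma toWord_mk_mul (d : Dart E) (g : FreeGroup E) :
    (FreeGroup.mk [d] * g).toWord =
      if g.toWord.head? = some (rev d) then g.toWord.tail else d :: g.toWord := by
  rw [FreeGroup.toWord_mul, toWord_mk_singleton, List.singleton_append, FreeGroup.reduce.cons,
    FreeGroup.reduce_toWord]
  cases h : g.toWord with
  | nil => simp
  | cons e t =>
    have : (d.1 = e.1 ∧ d.2 = !e.2) ↔ e = rev d := by
      rcases d with ⟨d, a⟩
      rcases e with ⟨e, b⟩
      cases a <;> cases b <;> simp [rev, eq_comm]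
    simp [this]

/-- As the last edge is the head of the list, following `d` is left multiplication by its letter;
appending and cancelling become a single equation. -/
lemma isLift_iff {d : Dart E} {x y : G.Cover v₀} :
    G.IsLift v₀ d x y ↔ toFree y = FreeGroup.mk [d] * toFree x := by
  constructor
  · rintro (h | h)
    · rw [toFree, h, toFree, FreeGroup.mul_mk]; rfl
    · rw [← inv_mul_eq_iff_eq_mul, ← mk_rev, toFree, toFree, h, FreeGroup.mul_mk]; rfl
  · intro h
    have h2 := congrArg FreeGroup.toWord h
    rw [toWord_mk_mul, toWord_toFree, toWord_toFree] at h2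
    split_ifs at h2 with hc
    · right
      rw [h2]
      exact (List.cons_head?_tail hc).symm
    · exact Or.inl h2

lemma exists_isLift {d : Dart E} {x : G.Cover v₀} (h : G.proj v₀ x = G.init d) :
    ∃ y, G.IsLift v₀ d x y :=
  ⟨ofFree _ ((joins_dart d).mul (h ▸ joins_toFree x)), isLift_iff.2 (toFree_ofFree _ _)⟩

lemma IsLift.right_unique {d : Dart E} {x y y' : G.Cover v₀} (h : G.IsLift v₀ d x y)
    (h' : G.IsLift v₀ d x y') : y = y' :=
  toFree_injective ((isLift_iff.1 h).trans (isLift_iff.1 h').symm)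

lemma IsLift.dart_unique {d d' : Dart E} {x y : G.Cover v₀} (h : G.IsLift v₀ d x y)
    (h' : G.IsLift v₀ d' x y) : d = d' :=
  mk_singleton_injective (mul_right_cancel ((isLift_iff.1 h).symm.trans (isLift_iff.1 h')))

lemma IsLift.jacobiMatrix_eq [Fintype E] (J : JacobiParameters V E) {d : Dart E}
    {x y : G.Cover v₀} (h : G.IsLift v₀ d x y) :
    G.jacobiMatrix J v₀ x y = J.a d.1 := by
  rw [jacobiMatrix, if_neg h.ne, Finset.sum_eq_single d, if_pos h]
  · exact fun d' _ hd' => if_neg fun h' => hd' (h'.dart_unique h)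
  · simp

/-! ### Branches -/

/-- The vertices of the universal cover that are reached from `x` by a geodesic that starts with the
lift of the oriented edge `d`. -/
def branch (d : Dart E) (x : G.Cover v₀) : Set (G.Cover v₀) :=
  {z | (toFree x * (toFree z)⁻¹).toWord.head? = some (rev d)}

/-- If `d` cancels a leading `rev d`, the letter that comes to the front is not `d`, since the word
was reduced. -/
lemma head?_toWord_mk_mul (d : Dart E) (g : FreeGroup E) :
    (FreeGroup.mk [d] * g).toWord.head? = some d ↔ g.toWord.head? ≠ some (rev d) := by
  rw [toWord_mk_mul]
  by_cases hc : g.toWord.head? = some (rev d)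
  · rw [if_pos hc]
    simp only [hc, ne_eq, not_true_eq_false, iff_false]
    intro ht
    have hr : FreeGroup.IsReduced g.toWord := FreeGroup.isReduced_toWord
    cases h : g.toWord with
    | nil => simp [h] at hc
    | cons e t =>
      rw [h] at hc ht hr
      cases t with
      | nil => simp at ht
      | cons f t =>
        obtain rfl : e = rev d := by simpa using hc
        obtain rfl : f = d := by simpa using ht
        exact (ne_rev_iff _ _).2 (FreeGroup.isReduced_cons_cons.1 hr).1 rfl
  · rw [if_neg hc]; simpa using hc

/-- Multiplying by one letter on the right alters only the far end of the reduced word; the first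
letter survives unless the word is or becomes empty. -/
lemma head?_toWord_mul_mk {g : FreeGroup E} {e : Dart E} (hg : g ≠ 1)
    (hge : g * FreeGroup.mk [e] ≠ 1) :
    (g * FreeGroup.mk [e]).toWord.head? = g.toWord.head? := by
  have hr : FreeGroup.IsReduced g.toWord := FreeGroup.isReduced_toWord
  rcases List.eq_nil_or_concat g.toWord with h | ⟨L, f, h⟩
  · exact absurd (FreeGroup.toWord_eq_nil_iff.1 h) hg
  · by_cases hf : f = rev e
    · have hgL : g * FreeGroup.mk [e] = FreeGroup.mk L := by
        rw [← FreeGroup.mk_toWord (x := g), h, hf, List.concat_eq_append, ← FreeGroup.mul_mk,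
          mk_rev, inv_mul_cancel_right]
      have hL : (FreeGroup.mk L).toWord = L := by
        refine FreeGroup.IsReduced.reduce_eq (hr.infix ⟨[], [f], ?_⟩)
        rw [h]; simp
      rw [hgL] at hge ⊢
      rw [hL, h]
      cases L with
      | nil => exact absurd rfl hge
      | cons a L => rfl
    · have hred : FreeGroup.IsReduced (g.toWord ++ [e]) := by
        rw [h, List.concat_eq_append]
        refine FreeGroup.IsReduced.append_overlap ?_ ?_ (by simp)
        · rw [← List.concat_eq_append, ← h]; exact hr
        · exact FreeGroup.isReduced_cons_cons.2 ⟨(ne_rev_iff _ _).1 hf, .singleton⟩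
      rw [FreeGroup.toWord_mul, toWord_mk_singleton, hred.reduce_eq, h]
      cases L <;> rfl

lemma notMem_branch_self (d : Dart E) (x : G.Cover v₀) : x ∉ branch d x := by
  simp [branch]

lemma IsLift.branch_rev {d : Dart E} {x y : G.Cover v₀} (h : G.IsLift v₀ d x y) :
    branch (rev d) y = (branch d x)ᶜ := by
  ext z
  simp only [branch, Set.mem_compl_iff, Set.mem_ofPred_eq, rev_rev]
  rw [isLift_iff.1 h, mul_assoc, head?_toWord_mk_mul]

lemma IsLift.isCut [Fintype E] (J : JacobiParameters V E) {d : Dart E} {x y : G.Cover v₀}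
    (h : G.IsLift v₀ d x y) : IsCut (G.jacobiMatrix J v₀) x y (branch d x) where
  notMem := notMem_branch_self d x
  mem := by
    rw [branch, Set.mem_ofPred_eq, isLift_iff.1 h, mul_inv_rev, mul_inv_cancel_left, ← mk_rev]
    rfl
  crossing := by
    intro z hz w hw hzw
    have hne : z ≠ w := fun he => hw (he ▸ hz)
    obtain ⟨d', hd'⟩ := exists_isLift_of_jacobiMatrix_ne_zero J hne hzw
    -- Moving from `z` to its neighbor `w` changes the word of the geodesic to `x` only at its
    -- starting end. Its final edge, and with it the branch, stays the same unless `w = x`.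
    have hxw : toFree x * (toFree w)⁻¹ = toFree x * (toFree z)⁻¹ * FreeGroup.mk [rev d'] := by
      rw [isLift_iff.1 hd', mul_inv_rev, mk_rev, mul_assoc]
    have hg : toFree x * (toFree z)⁻¹ ≠ 1 := by
      intro h1
      rw [branch, Set.mem_ofPred_eq, h1] at hz
      simp at hz
    by_cases hge : toFree x * (toFree z)⁻¹ * FreeGroup.mk [rev d'] = 1
    · have hxw1 : x = w := toFree_injective (mul_inv_eq_one.1 (hxw.trans hge))
      refine ⟨?_, hxw1.symm⟩
      have h2 : toFree x * (toFree z)⁻¹ = FreeGroup.mk [d'] := by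
        rw [mk_rev, mul_inv_eq_one] at hge
        exact hge
      rw [branch, Set.mem_ofPred_eq, h2, toWord_mk_singleton] at hz
      have h3 : d' = rev d := by simpa using hz
      subst hxw1 h3
      exact ((G.isLift_rev v₀ d z x).1 hd').right_unique h
    · refine absurd ?_ hw
      rw [branch, Set.mem_ofPred_eq, hxw, head?_toWord_mul_mk hg hge]
      exact hz

/-- The geodesic from `z` to `x` is nonempty, and the reverse of its final edge is the direction
sought. -/
lemma existsUnique_mem_branch {x z : G.Cover v₀} (hz : z ≠ x) :
    ∃! d : {d : Dart E // G.init d = G.proj v₀ x}, z ∈ branch d.1 x := by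
  have hj : G.Joins (G.proj v₀ z) (G.proj v₀ x) (toFree x * (toFree z)⁻¹) :=
    (joins_toFree x).mul (joins_toFree z).inv
  cases h : (toFree x * (toFree z)⁻¹).toWord with
  | nil =>
    rw [FreeGroup.toWord_eq_nil_iff, mul_inv_eq_one] at h
    exact absurd (toFree_injective h).symm hz
  | cons e t =>
    rw [Joins, h] at hj
    refine ⟨⟨rev e, (G.init_rev e).trans hj.1⟩, ?_, ?_⟩
    · simp [branch, h, rev_rev]
    · rintro ⟨d, hd⟩ hd'
      simp only [branch, Set.mem_ofPred_eq, h, List.head?_cons, Option.some.injEq] at hd'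
      simp [hd', rev_rev]

/-! ### Deck transformations -/

/-- Right multiplication by `x⁻¹ x'`, the word of a closed walk at `v₀`. It commutes with left
multiplication by letters, hence preserves lifts of edges, and it cancels in `w z⁻¹`, hence
preserves branches. -/
lemma exists_deckTransformation {x x' : G.Cover v₀} (h : G.proj v₀ x = G.proj v₀ x') :
    ∃ φ : G.Cover v₀ ≃ G.Cover v₀, φ x = x' ∧
      (∀ d z w, G.IsLift v₀ d (φ z) (φ w) ↔ G.IsLift v₀ d z w) ∧
      (∀ z, G.proj v₀ (φ z) = G.proj v₀ z) ∧
      ∀ d z w, φ z ∈ branch d (φ w) ↔ z ∈ branch d w := by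
  have hγ : ∀ {x x' : G.Cover v₀}, G.proj v₀ x = G.proj v₀ x' →
      G.Joins v₀ v₀ ((toFree x)⁻¹ * toFree x') := fun {x x'} h =>
    (joins_toFree x).inv.mul (h ▸ joins_toFree x')
  let f : (x x' : G.Cover v₀) → G.proj v₀ x = G.proj v₀ x' → G.Cover v₀ → G.Cover v₀ :=
    fun x x' h z => ofFree (toFree z * ((toFree x)⁻¹ * toFree x')) ((joins_toFree z).mul (hγ h))
  have hf : ∀ x x' h z, toFree (f x x' h z) = toFree z * ((toFree x)⁻¹ * toFree x') :=
    fun x x' h z => toFree_ofFree _ _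
  refine ⟨⟨f x x' h, f x' x h.symm, fun z => toFree_injective ?_, fun z => toFree_injective ?_⟩,
    toFree_injective ?_, fun d z w => ?_, fun z => ?_, fun d z w => ?_⟩
  · simp only [hf]; group
  · simp only [hf]; group
  · exact (hf x x' h x).trans (by group)
  · change G.IsLift v₀ d (f x x' h z) (f x x' h w) ↔ _
    simp only [isLift_iff, hf]
    rw [← mul_assoc (FreeGroup.mk [d]), mul_left_inj]
  · exact proj_ofFree _ ((joins_toFree z).mul (hγ h))
  · change f x x' h z ∈ branch d (f x x' h w) ↔ _
    simp only [branch, Set.mem_ofPred_eq, hf]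
    rw [mul_inv_rev, mul_assoc, mul_inv_cancel_left]

end Multigraph

/-! ### Mass balance on the finite graph. -/

namespace Multigraph

variable {V E : Type*} [Fintype E] {G : Multigraph V E}
  {J : JacobiParameters V E} {v₀ : V} {lam : ℝ}

lemma exists_symmetry [DecidableEq E] (J : JacobiParameters V E) {x x' : G.Cover v₀}
    (h : G.proj v₀ x = G.proj v₀ x') :
    ∃ φ : G.Cover v₀ ≃ G.Cover v₀, φ x = x' ∧
      (∀ z w, G.jacobiMatrix J v₀ (φ z) (φ w) = G.jacobiMatrix J v₀ z w) ∧
      ∀ d z w, φ z ∈ branch d (φ w) ↔ z ∈ branch d w := by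
  obtain ⟨φ, h1, h2, h3, h4⟩ := exists_deckTransformation h
  refine ⟨φ, h1, fun z w => ?_, h4⟩
  unfold jacobiMatrix
  simp only [φ.apply_eq_iff_eq, h3]
  by_cases hzw : z = w
  · simp only [if_pos hzw]
  · simp only [if_neg hzw]
    refine Finset.sum_congr rfl fun d _ => ?_
    by_cases hl : G.IsLift v₀ d z w
    · rw [if_pos hl, if_pos ((h2 d z w).2 hl)]
    · rw [if_neg hl, if_neg fun hl' => hl ((h2 d z w).1 hl')]

variable [Fintype V]

variable (G J v₀ lam) in
/-- The projection of `δ_x` to the eigenspace of the Jacobi operator at `lam`. -/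
noncomputable abbrev column (x : G.Cover v₀) : EllTwo (G.Cover v₀) :=
  eigenColumn (G.jacobiMatrix_isSchurBounded J v₀) lam x

variable (G J v₀ lam) in
/-- The fraction of the squared norm of `column x` that is carried by the branch at `x` in the
direction `d`. -/
noncomputable def branchFraction [DecidableEq E] (d : Dart E) (x : G.Cover v₀) : ℝ :=
  massFraction (G.jacobiMatrix_isSchurBounded J v₀) lam x (branch d x)

lemma norm_sq_column_eq {x x' : G.Cover v₀} (h : G.proj v₀ x = G.proj v₀ x') :
    ‖G.column J v₀ lam x‖ ^ 2 = ‖G.column J v₀ lam x'‖ ^ 2 := by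
  classical
  obtain ⟨φ, rfl, hφ, -⟩ := exists_symmetry J h
  exact (norm_sq_eigenColumn_symmetry hφ x).symm

lemma branchFraction_eq [DecidableEq E] (d : Dart E) {x x' : G.Cover v₀}
    (h : G.proj v₀ x = G.proj v₀ x') :
    G.branchFraction J v₀ lam d x = G.branchFraction J v₀ lam d x' := by
  obtain ⟨φ, rfl, hφ, hb⟩ := exists_symmetry J h
  exact (massFraction_symmetry hφ x fun z => hb d z x).symm

/-- By deck invariance the norm of a column is constant on fibers, so a column that is nonzero at
one lift of a vertex is nonzero at all of them. -/
lemma proj_mem_eigenVertices_iff (x : G.Cover v₀) :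
    G.proj v₀ x ∈ G.eigenVertices J v₀ lam ↔ G.column J v₀ lam x ≠ 0 := by
  constructor
  · rintro ⟨x', hx', ψ, hψ, hne⟩
    have h : G.column J v₀ lam x' ≠ 0 := eigenColumn_ne_zero_iff.2 ⟨ψ, mem_eigenKer.2 hψ, hne⟩
    rw [← norm_ne_zero_iff, ← pow_ne_zero_iff two_ne_zero] at h ⊢
    rwa [← norm_sq_column_eq hx']
  · intro h
    obtain ⟨ψ, hψ, hne⟩ := eigenColumn_ne_zero_iff.1 h
    exact ⟨x, rfl, ψ, mem_eigenKer.1 hψ, hne⟩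

lemma sum_branchFraction_out [DecidableEq E] [DecidableEq V] {x : G.Cover v₀}
    (hx : G.proj v₀ x ∈ G.eigenVertices J v₀ lam) :
    ∑ d with G.init d = G.proj v₀ x, G.branchFraction J v₀ lam d x
      = 1 - ‖G.column J v₀ lam x‖ ^ 2 := by
  rw [Finset.sum_subtype (p := fun d => G.init d = G.proj v₀ x) _ (by simp)]
  exact sum_massFraction_of_partition
    (fun d : {d : Dart E // G.init d = G.proj v₀ x} => branch d.1 x) x
    (fun d => notMem_branch_self d.1 x) (fun z hz => existsUnique_mem_branch hz)
    ((proj_mem_eigenVertices_iff x).1 hx)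

lemma IsLift.branchFraction_add_rev [DecidableEq E] {d : Dart E} {x y : G.Cover v₀}
    (h : G.IsLift v₀ d x y) (hx : G.init d ∈ G.eigenVertices J v₀ lam)
    (hy : G.term d ∈ G.eigenVertices J v₀ lam) :
    G.branchFraction J v₀ lam d x + G.branchFraction J v₀ lam (rev d) y = 1 := by
  rw [← h.proj_left, proj_mem_eigenVertices_iff] at hx
  rw [← h.proj_right, proj_mem_eigenVertices_iff] at hy
  rw [branchFraction, branchFraction, h.branch_rev]
  refine massFraction_add_compl (h.isCut J) ?_ hx hy
  rw [h.jacobiMatrix_eq]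
  exact (J.a_pos _).ne'

/-- The equation `(H - lam) w = δ_y` is read at `y`, where `w` vanishes. A neighbor over `X₁`
contributes its branch fraction, any other contributes `0`. -/
lemma sum_branchFraction_in [DecidableEq E] [DecidableEq V] {y : G.Cover v₀}
    (lift : V → G.Cover v₀) (hlift : ∀ v, G.proj v₀ (lift v) = v)
    (hy : G.proj v₀ y ∈ G.outerBoundary (G.eigenVertices J v₀ lam)) :
    ∑ d with G.term d = G.proj v₀ y, (G.eigenVertices J v₀ lam).indicator
      (fun v => G.branchFraction J v₀ lam d (lift v)) (G.init d) = 1 := by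
  obtain ⟨hyX, u, hu, d₀, rfl, hd₀⟩ := hy
  have hx : ∀ d : {d : Dart E // G.term d = G.proj v₀ y}, ∃ x, G.IsLift v₀ d.1 x y := fun d => by
    obtain ⟨x, hx⟩ := exists_isLift (d := rev d.1) (d.2.symm.trans (G.init_rev d.1).symm)
    exact ⟨x, (G.isLift_rev v₀ d.1 y x).1 hx⟩
  choose X hX using hx
  have hne : ∀ d, G.jacobiMatrix J v₀ (X d) y ≠ 0 := fun d => by
    rw [(hX d).jacobiMatrix_eq]; exact (J.a_pos _).ne'
  -- Parallel edges, and the two orientations of a loop, lead to different neighbors in the tree, so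
  -- neighbors of `y` may be indexed by the oriented edges that end below it.
  have hinj : Function.Injective X := fun d d' h => by
    have h' := hX d'
    rw [← h] at h'
    exact Subtype.ext ((hX d).dart_unique h')
  have hX₀ := hX ⟨d₀, hd₀⟩
  have hcol : ∀ d, G.column J v₀ lam (X d) ≠ 0 ↔ G.init d.1 ∈ G.eigenVertices J v₀ lam := fun d => by
    rw [← (hX d).proj_left, proj_mem_eigenVertices_iff]
  have hycol : G.column J v₀ lam y = 0 := by
    by_contra h
    exact hyX ((proj_mem_eigenVertices_iff y).2 h)
  obtain ⟨w, hw1, hwy, hw0, hw⟩ := exists_preimage_deltaVec (hX₀.isCut J) (hne _)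
    ((hcol _).2 hu) hycol
  have hval : ∑' z, (G.jacobiMatrix J v₀ y z : ℂ) * w z = 1 := by
    have h := congrArg (fun f : EllTwo (G.Cover v₀) => f y) hw1
    change matrixOperator _ (G.jacobiMatrix_isSchurBounded J v₀) w y - (lam : ℂ) * w y
      = (deltaVec y : EllTwo _) y at h
    rwa [hwy, mul_zero, sub_zero, deltaVec_self, matrixOperator_apply] at h
  rw [← hinj.tsum_eq (f := fun z => (G.jacobiMatrix J v₀ y z : ℂ) * w z), tsum_fintype] at hval
  · rw [Finset.sum_subtype (p := fun d => G.term d = G.proj v₀ y) _ (by simp)]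
    have h : ((∑ d : {d : Dart E // G.term d = G.proj v₀ y}, (G.eigenVertices J v₀ lam).indicator
      (fun v => G.branchFraction J v₀ lam d.1 (lift v)) (G.init d.1) : ℝ) : ℂ) = 1 := by
      rw [← hval, Complex.ofReal_sum]
      refine Finset.sum_congr rfl fun d _ => ?_
      rw [(G.jacobiMatrix_isSchurBounded J v₀).symm]
      by_cases hd : G.init d.1 ∈ G.eigenVertices J v₀ lam
      · rw [Set.indicator_of_mem hd, hw _ _ ((hX d).isCut J) (hne d) ((hcol d).2 hd),
          branchFraction_eq (x' := X d) d.1 ((hlift _).trans (hX d).proj_left.symm)]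
        rfl
      · rw [Set.indicator_of_notMem hd, hw0 (X d) (by by_contra h; exact hd ((hcol d).1 h))]
        simp
    exact_mod_cast h
  · intro z hz
    have hz' : (G.jacobiMatrix J v₀ y z : ℂ) * w z ≠ 0 := hz
    have hyz : y ≠ z := by
      rintro rfl
      exact hz' (by rw [hwy, mul_zero])
    obtain ⟨d, hd⟩ := exists_isLift_of_jacobiMatrix_ne_zero J hyz
      (by exact_mod_cast left_ne_zero_of_mul hz')
    have hd' := (G.isLift_rev v₀ d z y).2 hd
    refine ⟨⟨rev d, hd'.proj_right.symm⟩, ?_⟩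
    have h2 := (G.isLift_rev v₀ (rev d) y _).2 (hX ⟨rev d, hd'.proj_right.symm⟩)
    rw [rev_rev] at h2
    exact h2.right_unique hd

lemma ncard_eq_sum_indicator {α : Type*} [Fintype α] (X : Set α) :
    (X.ncard : ℝ) = ∑ v, X.indicator 1 v := by
  classical
  rw [Set.ncard_eq_toFinset_card', Finset.sum_indicator_eq_sum_filter]
  simp only [Pi.one_apply, Finset.sum_const, nsmul_eq_mul, mul_one]
  congr 2
  ext; simp

/-- The trace per fundamental domain of the eigenprojection is the index. -/
theorem sum_norm_sq_column (lift : V → G.Cover v₀) (hlift : ∀ v, G.proj v₀ (lift v) = v) :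
    ∑ v, ‖G.column J v₀ lam (lift v)‖ ^ 2 = (G.aomotoIndex J v₀ lam : ℝ) := by
  classical
  set X := G.eigenVertices J v₀ lam
  set g : Dart E → ℝ := fun d => G.branchFraction J v₀ lam d (lift (G.init d))
  have hvert : ∀ v, ‖G.column J v₀ lam (lift v)‖ ^ 2
      = X.indicator 1 v - ∑ d with G.init d = v, X.indicator (fun _ => g d) (G.init d) := by
    intro v
    by_cases hv : v ∈ X
    · rw [Set.indicator_of_mem hv]
      have h := sum_branchFraction_out (J := J) (lam := lam) (x := lift v) (by rwa [hlift])
      rw [hlift] at h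
      rw [eq_sub_iff_add_eq, Pi.one_apply, ← eq_sub_iff_add_eq', ← h]
      refine Finset.sum_congr rfl fun d hd => ?_
      obtain rfl : G.init d = v := by simpa using hd
      rw [Set.indicator_of_mem hv]
    · have h : G.column J v₀ lam (lift v) = 0 := by
        by_contra h
        rw [← Ne, ← proj_mem_eigenVertices_iff, hlift] at h
        exact hv h
      rw [h, Set.indicator_of_notMem hv, Finset.sum_eq_zero]
      · simp
      · intro d hd
        obtain rfl : G.init d = v := by simpa using hd
        exact Set.indicator_of_notMem hv _
  -- An oriented edge that starts in `X` either lies inside `X` or ends outside `X`, in its outer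
  -- boundary.
  have hsplit : ∀ d : Dart E, X.indicator (fun _ => g d) (G.init d)
      = (G.edgesInside X).indicator (fun _ => g d) d.1
        + Xᶜ.indicator (fun _ => X.indicator (fun _ => g d) (G.init d)) (G.term d) := by
    rintro ⟨e, b⟩
    by_cases h1 : G.src e ∈ X <;> by_cases h2 : G.tgt e ∈ X <;> cases b <;>
      simp [edgesInside, init, term, h1, h2]
  have hedge : ∑ d : Dart E, (G.edgesInside X).indicator (fun _ => g d) d.1
      = (G.edgesInside X).ncard := by
    rw [ncard_eq_sum_indicator, Fintype.sum_prod_type]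
    refine Finset.sum_congr rfl fun e _ => ?_
    rw [Fintype.sum_bool]
    by_cases he : e ∈ G.edgesInside X
    · simp only [Set.indicator_of_mem he]
      -- The chosen lifts of the two ends need not be adjacent; `y` is the true neighbor, and
      -- `branchFraction_eq` transfers the fraction to the chosen lift.
      obtain ⟨y, hy⟩ := exists_isLift (d := (e, false)) (x := lift (G.src e)) (hlift _)
      have h := hy.branchFraction_add_rev (J := J) (lam := lam) he.1 he.2
      rw [add_comm, Pi.one_apply, ← h]
      congr 1
      exact branchFraction_eq _ ((hlift _).trans hy.proj_right.symm)
    · simp only [Set.indicator_of_notMem he, add_zero]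
  have hbdry : ∑ d : Dart E, Xᶜ.indicator (fun _ => X.indicator (fun _ => g d) (G.init d)) (G.term d)
      = (G.outerBoundary X).ncard := by
    rw [ncard_eq_sum_indicator, ← Finset.sum_fiberwise Finset.univ G.term]
    refine Finset.sum_congr rfl fun v _ => ?_
    by_cases hv : v ∈ G.outerBoundary X
    · rw [Set.indicator_of_mem hv, Pi.one_apply]
      have h := sum_branchFraction_in (J := J) (lam := lam) (y := lift v) lift hlift
        (by rwa [hlift])
      rw [hlift] at h
      rw [← h]
      refine Finset.sum_congr rfl fun d hd => ?_
      obtain rfl : G.term d = v := by simpa using hd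
      rw [Set.indicator_of_mem (s := Xᶜ) hv.1]
      by_cases h1 : G.init d ∈ X
      · rw [Set.indicator_of_mem h1, Set.indicator_of_mem h1]
      · rw [Set.indicator_of_notMem h1, Set.indicator_of_notMem h1]
    · rw [Set.indicator_of_notMem hv]
      refine Finset.sum_eq_zero fun d hd => ?_
      obtain rfl : G.term d = v := by simpa using hd
      by_cases h1 : G.term d ∈ X
      · exact Set.indicator_of_notMem (Set.notMem_compl_iff.2 h1) _
      · rw [Set.indicator_of_mem (s := Xᶜ) h1]
        exact Set.indicator_of_notMem (fun h2 => hv ⟨h1, _, h2, d, rfl, rfl⟩) _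
  simp only [hvert]
  rw [Finset.sum_sub_distrib,
    Finset.sum_fiberwise Finset.univ G.init fun d => X.indicator (fun _ => g d) (G.init d),
    ← ncard_eq_sum_indicator,
    Finset.sum_congr rfl fun d _ => hsplit d, Finset.sum_add_distrib, hedge, hbdry, aomotoIndex]
  push_cast
  ring

end Multigraph

/-! ### The point mass of the density of states. -/

theorem theorem1p2 {V E : Type*} [Fintype V] [Fintype E] (G : Multigraph V E)
    (hconn : G.IsConnected) (hleaf : G.IsLeafless) (J : Multigraph.JacobiParameters V E)
    (v₀ : V) (lift : V → G.Cover v₀) (hlift : ∀ v, G.proj v₀ (lift v) = v)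
    (lam : ℝ)
    (hlam : Module.End.HasEigenvalue (G.jacobiOperator J v₀).toLinearMap (lam : ℂ)) :
    0 < G.aomotoIndex J v₀ lam ∧
      G.densityOfStates J v₀ lift {lam} =
        ENNReal.ofReal ((G.aomotoIndex J v₀ lam : ℝ) / (Fintype.card V : ℝ)) := by
  have hsum := Multigraph.sum_norm_sq_column (J := J) (lam := lam) lift hlift
  have hcard : (0 : ℝ) < Fintype.card V := by
    exact_mod_cast Fintype.card_pos_iff.2 ⟨v₀⟩
  constructor
  · obtain ⟨ψ, hψ⟩ := hlam.exists_hasEigenvector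
    obtain ⟨x, hx⟩ : ∃ x, ψ x ≠ 0 := by
      by_contra! h
      exact hψ.2 (lp.ext (funext h))
    have hpos : 0 < ‖G.column J v₀ lam (lift (G.proj v₀ x))‖ ^ 2 := by
      rw [Multigraph.norm_sq_column_eq (x' := x) (hlift _)]
      exact pow_pos (norm_pos_iff.2 (eigenColumn_ne_zero_iff.2
        ⟨ψ, mem_eigenKer.2 hψ.apply_eq_smul, hx⟩)) 2
    have h : (0 : ℝ) < G.aomotoIndex J v₀ lam := by
      rw [← hsum]
      exact Finset.sum_pos' (fun v _ => by positivity) ⟨_, Finset.mem_univ _, hpos⟩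
    exact_mod_cast h
  · rw [Multigraph.densityOfStates, MeasureTheory.Measure.smul_apply,
      MeasureTheory.Measure.finsetSum_apply]
    simp only [spectralMeasure_singleton]
    rw [← ENNReal.ofReal_sum_of_nonneg fun v _ => by positivity, smul_eq_mul,
      ENNReal.ofReal_div_of_pos hcard, ENNReal.ofReal_natCast, mul_comm, ← div_eq_mul_inv, ← hsum]
    rfl
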